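/- Let $H$ be a real Hilbert space, let $U_1:H\rightrightarrows H$ be maximal monotone and let $U_2:H\to H$ be $\delta$-cocoercive for some $\delta>0$, i.e. $\langle x-y,U_2(x)-U_2(y)\rangle\ge\delta\|U_2(x)-U_2(y)\|^2$ for all $x,y\in H$. Let $c\in(0,2\delta]$ and let $J_{cU_1}=(I+cU_1)^{-1}$ be the resolvent of $cU_1$. Given $(\alpha_n)\subset[0,1]$, $(\beta_n)\subset[1-\frac{4\delta-c}{2\delta},1]$ and $x_0,u\in H$, let $(x_n)$ be generated by $$x_{2n+1}=(1-\alpha_n)x_{2n}+\alpha_n u,\qquad x_{2n+2}=(1-\beta_n)J_{cU_1}\big(x_{2n+1}-cU_2(x_{2n+1})\big)+\beta_n x_{2n+1}\qquad(n\ge 0).\tag{GFB}$$ Let $\Gamma_1,\Gamma_3,\Gamma_4:(0,\infty)\to\mathbb N$ be nonincreasing and $\Gamma_2:\mathbb N\to\mathbb N$ nondecreasing functions such that for all $\varepsilon>0$ and $k,n\in\mathbb N$: $$\alpha_m\le\varepsilon\ \text{ for all } m\ge\Gamma_1(\varepsilon);\qquad \sum_{i=0}^{\Gamma_2(k)}\alpha_i\ge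 k;\qquad \sum_{i=\Gamma_3(\varepsilon)+1}^{\Gamma_3(\varepsilon)+n}|\alpha_{i+1}-\alpha_i|\le\varepsilon;\qquad \sum_{i=\Gamma_4(\varepsilon)+1}^{\Gamma_4(\varepsilon)+n}|\beta_{i+1}-\beta_i|\le\varepsilon .$$ Assume that there are $N\in\mathbb N\setminus\{0\}$ with $N\ge\max\{\|x_0-p\|,2\|u-p\|\}$ for some $p\in\mathrm{zer}(U_1+U_2)$, and $\gamma\in(0,1]$ with $1-\frac{4\delta-c}{2\delta}+\gamma\le\beta_n\le1-\gamma$ for all $n\in\mathbb N$. Then $(x_n)$ converges strongly to $P_{\mathrm{zer}(U_1+U_2)}(u)$, the unique point of $\mathrm{zer}(U_1+U_2)=\{x: 0\in U_1(x)+U_2(x)\}$ nearest to $u$, and $\mu[N,\gamma/2,\Gamma_1,\Gamma_2,\Gamma_3,\Gamma_4]$ is a rate of metastability for $(x_n)$: writing $\mu$ for this functional, $$\forall\varepsilon>0\ \forall f:\mathbb N\to\mathbb N\ \exists n\le\mu(\varepsilon,f)\ \forall i,j\in[n,f(n)]\ \big(\|x_i-x_j\|\le\varepsilon\big).$$ Here,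 for $g\in(0,1)$, the functional $\mu[N,g,\Gamma_1,\Gamma_2,\Gamma_3,\Gamma_4]$ is defined as follows, where $\lceil t\rceil$ denotes the integer ceiling replaced by $0$ if it is negative, and $d^{(i)}$ the $i$-th iterate of $d$. For $\varepsilon>0$ put $$\theta_1(\varepsilon)=\Gamma_2\Big(\max\{\Gamma_3(\tfrac{\varepsilon}{8N}),\Gamma_4(\tfrac{\varepsilon}{8N})\}+\lceil\ln\tfrac{4N}{\varepsilon}\rceil+2\Big)+1,\qquad \theta_3(\varepsilon)=\max\Big\{\theta_1\big(\tfrac{(g\varepsilon)^2}{8N}\big),\Gamma_1\big(\tfrac{(g\varepsilon)^2}{2N^2}\big)\Big\},$$ $$\theta_4(\varepsilon)=\max\{\theta_1(\tfrac\varepsilon2),\theta_3(\tfrac\varepsilon2)\},\qquad \rho_2(\varepsilon)=2\theta_3(\tfrac\varepsilon3)+2,\qquad \rho_3(\varepsilon)=2\max\{\theta_4(\tfrac\varepsilon6),\Gamma_1(\tfrac{\varepsilon}{4N})\}+1,\qquad \rho=\max\{\rho_2,\rho_3\}.$$ For $\varepsilon>0$, $d:(0,1]\to(0,1]$ and $\Delta:\mathbb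 N\to(0,1]$ put $$\varphi(\varepsilon,d)=\min\{d^{(i)}(1): 0\le i\le\lceil\tfrac{N^2}{4\varepsilon}\rceil\},\qquad \Phi(\varepsilon,d)=\frac{\varphi\big(\frac{\varepsilon^2}{4N^2},\tilde d\big)^2}{24N}\ \text{ with }\ \tilde d(\xi)=\min\{d(\tfrac{\xi^2}{24N}),\tfrac{\xi^2}{24N}\},\qquad \Psi(\varepsilon,\Delta)=\rho\big(\Phi(\varepsilon,\Delta\circ\rho)\big).$$ Finally, for $\varepsilon>0$ and $f:\mathbb N\to\mathbb N$, with $\tilde\varepsilon=\varepsilon^2/16$, $$\Sigma(n)=\Gamma_2\Big(\max\{n,\rho_3(\tfrac{\tilde\varepsilon}{36N})\}+\lceil\ln\tfrac{12N^2}{\tilde\varepsilon}\rceil\Big)+1,\qquad P(n)=f\big(2\max\{\Sigma(n),\theta_4(\tfrac\varepsilon4)\}+1\big),$$ $$\Delta_{\varepsilon,f}(n)=\min\Big\{\frac{\tilde\varepsilon}{30N(P(n)+1)},1\Big\},\qquad \mu(\varepsilon,f)=2\max\Big\{\Sigma\big(\Psi(\tfrac{\tilde\varepsilon}{24},\Delta_{\varepsilon,f})\big),\theta_4(\tfrac\varepsilon4)\Big\}+1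 .$$ -/

import Mathlib

namespace HalpernMann

/-! ### Rates -/

/-- `g` is a (monotone) rate of convergence of `a` towards zero:
`|a n| ≤ ε` for all `ε > 0` and `n ≥ g ε`, and `g` is nonincreasing on `(0, ∞)`. -/
def IsMonotoneRateToZero (a : ℕ → ℝ) (g : ℝ → ℕ) : Prop :=
  (∀ ε : ℝ, 0 < ε → ∀ n : ℕ, g ε ≤ n → |a n| ≤ ε) ∧
  ∀ ε ε' : ℝ, 0 < ε → ε ≤ ε' → g ε' ≤ g ε

/-- `g` is a (monotone) rate of divergence of the series `∑ a i`. -/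
def IsMonotoneRateOfDivergence (a : ℕ → ℝ) (g : ℕ → ℕ) : Prop :=
  (∀ k : ℕ, (k : ℝ) ≤ ∑ i ∈ Finset.Icc 0 (g k), a i) ∧
  ∀ k k' : ℕ, k ≤ k' → g k ≤ g k'

/-- `g` is a (monotone) Cauchy rate of the series `∑ |a (i+1) - a i|`. -/
def IsMonotoneCauchyRateOfVariation (a : ℕ → ℝ) (g : ℝ → ℕ) : Prop :=
  (∀ ε : ℝ, 0 < ε → ∀ n : ℕ,
    ∑ i ∈ Finset.Icc (g ε + 1) (g ε + n), |a (i + 1) - a i| ≤ ε) ∧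
  ∀ ε ε' : ℝ, 0 < ε → ε ≤ ε' → g ε' ≤ g ε

/-- `m` is a rate of metastability for the sequence `x`. -/
def IsRateOfMetastability {X : Type*} [MetricSpace X] (x : ℕ → X)
    (m : ℝ → (ℕ → ℕ) → ℕ) : Prop :=
  ∀ ε : ℝ, 0 < ε → ∀ f : ℕ → ℕ, ∃ n : ℕ, n ≤ m ε f ∧
    ∀ i ∈ Set.Icc n (f n), ∀ j ∈ Set.Icc n (f n), dist (x i) (x j) ≤ ε

/-! ### The functional `μ[N, γ, Γ₁, Γ₂, Γ₃, Γ₄]`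

Functions on `(0, ∞)` or `(0, 1]` are represented by functions on `ℝ`, only their values on these
intervals matter. The ceiling `⌈·⌉₊` is the integer ceiling truncated below at `0`. -/

/-- `θ̂[A, V, D](ε) = A(V(ε/2) + ⌈ln(2D/ε)⌉ + 1) + 1`. -/
noncomputable def thetaHat (A : ℕ → ℕ) (V : ℝ → ℕ) (D : ℕ) (ε : ℝ) : ℕ :=
  A (V (ε / 2) + ⌈Real.log (2 * (D : ℝ) / ε)⌉₊ + 1) + 1

/-- `σ[A, D](ε, K) = A(K + ⌈ln(3D/ε)⌉) + 1`. -/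
noncomputable def sigma (A : ℕ → ℕ) (D : ℕ) (ε : ℝ) (K : ℕ) : ℕ :=
  A (K + ⌈Real.log (3 * (D : ℝ) / ε)⌉₊) + 1

noncomputable def theta1 (N : ℕ) (Γ₂ : ℕ → ℕ) (Γ₃ Γ₄ : ℝ → ℕ) (ε : ℝ) : ℕ :=
  thetaHat (fun k => Γ₂ (k + 1))
    (fun η => max (Γ₃ (η / (4 * (N : ℝ)))) (Γ₄ (η / (4 * (N : ℝ))))) (2 * N) ε

noncomputable def theta3 (N : ℕ) (γ : ℝ) (Γ₁ : ℝ → ℕ) (Γ₂ : ℕ → ℕ) (Γ₃ Γ₄ : ℝ → ℕ)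
    (ε : ℝ) : ℕ :=
  max (theta1 N Γ₂ Γ₃ Γ₄ ((γ * ε) ^ 2 / (8 * (N : ℝ))))
    (Γ₁ ((γ * ε) ^ 2 / (2 * (N : ℝ) ^ 2)))

noncomputable def theta4 (N : ℕ) (γ : ℝ) (Γ₁ : ℝ → ℕ) (Γ₂ : ℕ → ℕ) (Γ₃ Γ₄ : ℝ → ℕ)
    (ε : ℝ) : ℕ :=
  max (theta1 N Γ₂ Γ₃ Γ₄ (ε / 2)) (theta3 N γ Γ₁ Γ₂ Γ₃ Γ₄ (ε / 2))

noncomputable def rho2 (N : ℕ) (γ : ℝ) (Γ₁ : ℝ → ℕ) (Γ₂ : ℕ → ℕ) (Γ₃ Γ₄ : ℝ → ℕ)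
    (ε : ℝ) : ℕ :=
  2 * theta3 N γ Γ₁ Γ₂ Γ₃ Γ₄ (ε / 3) + 2

noncomputable def rho3 (N : ℕ) (γ : ℝ) (Γ₁ : ℝ → ℕ) (Γ₂ : ℕ → ℕ) (Γ₃ Γ₄ : ℝ → ℕ)
    (ε : ℝ) : ℕ :=
  2 * max (theta4 N γ Γ₁ Γ₂ Γ₃ Γ₄ (ε / 6)) (Γ₁ (ε / (4 * (N : ℝ)))) + 1

noncomputable def rho (N : ℕ) (γ : ℝ) (Γ₁ : ℝ → ℕ) (Γ₂ : ℕ → ℕ) (Γ₃ Γ₄ : ℝ → ℕ)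
    (ε : ℝ) : ℕ :=
  max (rho2 N γ Γ₁ Γ₂ Γ₃ Γ₄ ε) (rho3 N γ Γ₁ Γ₂ Γ₃ Γ₄ ε)

/-- `φ[N](ε, d) = min {d^(i)(1) : i ≤ r}` with `r = ⌈N² / (4ε)⌉`. -/
noncomputable def phi (N : ℕ) (ε : ℝ) (d : ℝ → ℝ) : ℝ :=
  (Finset.range (⌈(N : ℝ) ^ 2 / (4 * ε)⌉₊ + 1)).inf' Finset.nonempty_range_add_one
    (fun i => d^[i] 1)

/-- `Φ[N](ε, d) = φ(ε̃, d̃)² / (24N)` with `ε̃ = ε² / (4N²)` and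
`d̃(ξ) = min {d(ξ² / (24N)), ξ² / (24N)}`. -/
noncomputable def capPhi (N : ℕ) (ε : ℝ) (d : ℝ → ℝ) : ℝ :=
  (phi N (ε ^ 2 / (4 * (N : ℝ) ^ 2))
    (fun ξ => min (d (ξ ^ 2 / (24 * (N : ℝ)))) (ξ ^ 2 / (24 * (N : ℝ))))) ^ 2 / (24 * (N : ℝ))

/-- `Ψ[N, r](ε, Δ) = r(Φ[N](ε, Δ ∘ r))`. -/
noncomputable def capPsi (N : ℕ) (r : ℝ → ℕ) (ε : ℝ) (Δ : ℕ → ℝ) : ℕ :=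
  r (capPhi N ε (fun η => Δ (r η)))

/-- `Σ(n) = σ[Γ₂, 4N²](ε̃, K(n))` with `ε̃ = ε² / 16` and `K(n) = max {n, ρ₃(ε̃ / (36N))}`. -/
noncomputable def capSigma (N : ℕ) (γ : ℝ) (Γ₁ : ℝ → ℕ) (Γ₂ : ℕ → ℕ) (Γ₃ Γ₄ : ℝ → ℕ)
    (ε : ℝ) (n : ℕ) : ℕ :=
  sigma Γ₂ (4 * N ^ 2) (ε ^ 2 / 16)
    (max n (rho3 N γ Γ₁ Γ₂ Γ₃ Γ₄ (ε ^ 2 / 16 / (36 * (N : ℝ)))))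

/-- `P(n) = f(2 max {Σ(n), θ₄(ε/4)} + 1)`. -/
noncomputable def capP (N : ℕ) (γ : ℝ) (Γ₁ : ℝ → ℕ) (Γ₂ : ℕ → ℕ) (Γ₃ Γ₄ : ℝ → ℕ)
    (ε : ℝ) (f : ℕ → ℕ) (n : ℕ) : ℕ :=
  f (2 * max (capSigma N γ Γ₁ Γ₂ Γ₃ Γ₄ ε n) (theta4 N γ Γ₁ Γ₂ Γ₃ Γ₄ (ε / 4)) + 1)

/-- `Δ_{ε,f}(n) = min {ε̃ / (30N(P(n) + 1)), 1}` with `ε̃ = ε² / 16`. -/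
noncomputable def capDelta (N : ℕ) (γ : ℝ) (Γ₁ : ℝ → ℕ) (Γ₂ : ℕ → ℕ) (Γ₃ Γ₄ : ℝ → ℕ)
    (ε : ℝ) (f : ℕ → ℕ) (n : ℕ) : ℝ :=
  min (ε ^ 2 / 16 / (30 * (N : ℝ) * ((capP N γ Γ₁ Γ₂ Γ₃ Γ₄ ε f n : ℝ) + 1))) 1

/-- `μ[N, γ, Γ₁, Γ₂, Γ₃, Γ₄](ε, f) = 2 max {Σ(Ψ[N, ρ](ε̃ / 24, Δ_{ε,f})), θ₄(ε/4)} + 1`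
with `ε̃ = ε² / 16`. -/
noncomputable def mu (N : ℕ) (γ : ℝ) (Γ₁ : ℝ → ℕ) (Γ₂ : ℕ → ℕ) (Γ₃ Γ₄ : ℝ → ℕ)
    (ε : ℝ) (f : ℕ → ℕ) : ℕ :=
  2 * max
    (capSigma N γ Γ₁ Γ₂ Γ₃ Γ₄ ε
      (capPsi N (rho N γ Γ₁ Γ₂ Γ₃ Γ₄) (ε ^ 2 / 16 / 24) (capDelta N γ Γ₁ Γ₂ Γ₃ Γ₄ ε f)))
    (theta4 N γ Γ₁ Γ₂ Γ₃ Γ₄ (ε / 4)) + 1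

/-! ### Multi-valued operators on a real Hilbert space -/

section Operators

variable {H : Type*} [NormedAddCommGroup H] [InnerProductSpace ℝ H]

/-- A multi-valued operator `A : H ⇉ H` is monotone. -/
def IsMonotoneOp (A : H → Set H) : Prop :=
  ∀ x y x' y' : H, y ∈ A x → y' ∈ A x' → 0 ≤ inner ℝ (x - x') (y - y')

/-- `A` is maximal monotone: it is monotone and its graph is not properly contained in the graph
of a monotone operator. -/
def IsMaximalMonotoneOp (A : H → Set H) : Prop :=
  IsMonotoneOp A ∧ ∀ B : H → Set H, IsMonotoneOp B → (∀ x, A x ⊆ B x) → B = A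

/-- The operator `c A`. -/
def scaleOp (c : ℝ) (A : H → Set H) : H → Set H := fun x => {w | ∃ v ∈ A x, w = c • v}

/-- The sum of a multi-valued operator and a single-valued one. -/
def addOp (A : H → Set H) (B : H → H) : H → Set H := fun x => {w | ∃ v ∈ A x, w = v + B x}

/-- The zeros of `A`. -/
def zer (A : H → Set H) : Set H := {x | (0 : H) ∈ A x}

/-- The resolvent `J_A = (I + A)⁻¹`: `J_A x` is the point `y` with `x ∈ y + A y`
(such a point exists and is unique when `A` is maximal monotone). -/
noncomputable def resolventOp (A : H → Set H) (x : H) : H :=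
  Classical.epsilon fun y => ∃ v ∈ A y, x = y + v

/-- `U` is `δ`-cocoercive. -/
def IsCocoercive (δ : ℝ) (U : H → H) : Prop :=
  ∀ x y : H, δ * ‖U x - U y‖ ^ 2 ≤ inner ℝ (x - y) (U x - U y)

/-- `z` is the metric projection of `u` onto `S`: the unique point of `S` nearest to `u`. -/
def IsMetricProjection (S : Set H) (u z : H) : Prop :=
  z ∈ S ∧ (∀ y ∈ S, dist u z ≤ dist u y) ∧
    ∀ z' ∈ S, (∀ y ∈ S, dist u z' ≤ dist u y) → z' = z

/-- The sequence `x` is generated by the generalized forward-backward algorithm. -/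
def IsGFB (U₁ : H → Set H) (U₂ : H → H) (c : ℝ) (α β : ℕ → ℝ) (u : H) (x : ℕ → H) : Prop :=
  ∀ n : ℕ,
    x (2 * n + 1) = (1 - α n) • x (2 * n) + α n • u ∧
    x (2 * n + 2) =
      (1 - β n) • resolventOp (scaleOp c U₁) (x (2 * n + 1) - c • U₂ (x (2 * n + 1)))
        + β n • x (2 * n + 1)

end Operators

end HalpernMann

/-!
The forward-backward operator `T = J_{cU₁} ∘ (I - cU₂)` is averaged: `T = (1 - a) I + a S` with
`a = 2δ / (4δ - c) ≤ 1` and `S` nonexpansive (`norm_forwardBackwardRelax_sub_le`), and the fixed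
points of `S` are the zeros of `U₁ + U₂`. That the resolvent is defined everywhere is Minty's
theorem, which is obtained by minimising the strongly convex function `‖w‖² + s` over the convex
hull of the points `((y - v) / 2, ⟪y, v⟫)`, `(y, v)` in the graph. The algorithm therefore alternates
Halpern steps with Mann steps of `S`, whose weights `1 - a (1 - β n)` lie in `[γ/2, 1 - γ/2]` and
vary no more than `β n` does (`IsGFB.isHalpernMann`).

For such an iteration, Xu's lemma makes consecutive even terms close, and the strong convexity of
the squared norm then makes the sequence asymptotically regular with respect to `S`
(`norm_S_sub_le_of_rho_le`). In place of the projection of `u` onto the fixed points, an approximate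
fixed point `z` is used that is almost nearest to `u` among approximate fixed points; it is found
after boundedly many improvements (`exists_almost_nearest`) and almost satisfies the variational
inequality `⟪u - z, y - z⟫ ≤ 0` (`exists_inner_le_of_capPhi`). As the terms `y = x i` are eventually
approximate fixed points, the recursion for `‖x (2n) - z‖²` keeps the iteration near `z` on the whole
window `[n, f n]`, which is metastability (`IsHalpernMann.isRateOfMetastability`).

Metastability implies the Cauchy property, the limit is a fixed point, and the same recursion with an
arbitrary fixed point `q` in place of `z` gives `‖lim x - q‖² ≤ 2 ⟪u - q, lim x - q⟫`, which says that
the limit is no farther from `u` than `q`.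
-/

namespace HalpernMann

/-! ### Minty's theorem and the resolvent -/

section Operators

variable {H : Type*} [NormedAddCommGroup H] [InnerProductSpace ℝ H]

/-- Strong convexity of `(w, s) ↦ ‖w‖² + s` in `w` makes the first components of a minimising
sequence on a convex set converge; the inequality is the first-order optimality condition at the
limit. -/
theorem exists_norm_sq_le_of_convex [CompleteSpace H] {C : Set (H × ℝ)} (hC : Convex ℝ C)
    (hne : C.Nonempty) (hpos : ∀ q ∈ C, 0 ≤ ‖q.1‖ ^ 2 + q.2) :
    ∃ x : H, ∀ q ∈ C, ‖x‖ ^ 2 ≤ 2 * inner ℝ x q.1 + q.2 := by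
  set Q : H × ℝ → ℝ := fun q => ‖q.1‖ ^ 2 + q.2 with hQ
  set m : ℝ := sInf (Q '' C) with hm
  have hbdd : BddBelow (Q '' C) := ⟨0, by rintro _ ⟨q, hq, rfl⟩; exact hpos q hq⟩
  have hmle : ∀ q ∈ C, m ≤ Q q := fun q hq => csInf_le hbdd ⟨q, hq, rfl⟩
  have hm0 : 0 ≤ m := le_csInf (hne.image Q) (by rintro _ ⟨q, hq, rfl⟩; exact hpos q hq)
  have hex : ∀ n : ℕ, ∃ q ∈ C, Q q < m + 1 / ((n : ℝ) + 1) := by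
    intro n
    have hlt : m < m + 1 / ((n : ℝ) + 1) := by
      have : (0 : ℝ) < 1 / ((n : ℝ) + 1) := by positivity
      linarith
    obtain ⟨_, ⟨q, hq, rfl⟩, h⟩ := exists_lt_of_csInf_lt (hne.image Q) hlt
    exact ⟨q, hq, h⟩
  choose q hqC hqlt using hex
  have hinv : Filter.Tendsto (fun n : ℕ => 1 / ((n : ℝ) + 1)) Filter.atTop (nhds 0) :=
    tendsto_one_div_add_atTop_nhds_zero_nat
  have hseg : ∀ a ∈ C, ∀ b ∈ C, ∀ t : ℝ, 0 ≤ t → t ≤ 1 →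
      m ≤ Q a + 2 * t * inner ℝ a.1 (b.1 - a.1) + t ^ 2 * ‖b.1 - a.1‖ ^ 2 + t * (b.2 - a.2) := by
    intro a ha b hb t ht0 ht1
    have hmem : a + t • (b - a) ∈ C := hC.add_smul_sub_mem ha hb ⟨ht0, ht1⟩
    have h := hmle _ hmem
    have hexp : Q (a + t • (b - a))
        = Q a + 2 * t * inner ℝ a.1 (b.1 - a.1) + t ^ 2 * ‖b.1 - a.1‖ ^ 2 + t * (b.2 - a.2) := by
      simp only [hQ, Prod.fst_add, Prod.smul_fst, Prod.fst_sub, Prod.snd_add, Prod.smul_snd,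
        Prod.snd_sub, norm_add_sq_real, inner_smul_right, norm_smul, Real.norm_eq_abs, mul_pow,
        sq_abs, smul_eq_mul]
      ring
    rwa [hexp] at h
  have hquad : ∀ i j : ℕ, ‖(q i).1 - (q j).1‖ ^ 2
      ≤ 2 * (1 / ((i : ℝ) + 1) + 1 / ((j : ℝ) + 1)) := by
    intro i j
    have h := hseg _ (hqC i) _ (hqC j) (1 / 2) (by norm_num) (by norm_num)
    have hi := hqlt i
    have hj := hqlt j
    have e1 : ‖(q j).1 - (q i).1‖ ^ 2 = ‖(q i).1 - (q j).1‖ ^ 2 := by rw [norm_sub_rev]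
    have e2 : ‖(q i).1 - (q j).1‖ ^ 2
        = ‖(q i).1‖ ^ 2 - 2 * inner ℝ (q i).1 (q j).1 + ‖(q j).1‖ ^ 2 := norm_sub_sq_real _ _
    rw [inner_sub_right, real_inner_self_eq_norm_sq, e1] at h
    simp only [hQ] at h hi hj
    nlinarith
  have hcauchy : CauchySeq fun n => (q n).1 := by
    rw [Metric.cauchySeq_iff']
    intro ε hε
    have h4 : (0 : ℝ) < ε ^ 2 / 4 := by positivity
    obtain ⟨k, hk⟩ := exists_nat_one_div_lt h4
    refine ⟨k, fun n hn => ?_⟩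
    have h := hquad n k
    have hnk : 1 / ((n : ℝ) + 1) ≤ 1 / ((k : ℝ) + 1) := by
      have : (k : ℝ) ≤ n := by exact_mod_cast hn
      gcongr
    rw [dist_eq_norm]
    refine lt_of_pow_lt_pow_left₀ 2 hε.le ?_
    linarith
  obtain ⟨x, hx⟩ := cauchySeq_tendsto_of_complete hcauchy
  have hQlim : Filter.Tendsto (fun n => Q (q n)) Filter.atTop (nhds m) := by
    refine tendsto_of_tendsto_of_tendsto_of_le_of_le tendsto_const_nhds
      (by simpa using hinv.const_add m) (fun n => hmle _ (hqC n)) (fun n => (hqlt n).le)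
  refine ⟨x, fun b hb => ?_⟩
  have hslim : Filter.Tendsto (fun n => (q n).2) Filter.atTop (nhds (m - ‖x‖ ^ 2)) := by
    refine (hQlim.sub (hx.norm.pow 2)).congr fun n => ?_
    simp [hQ]
  have hlim : ∀ t : ℝ, 0 ≤ t → t ≤ 1 →
      m ≤ m + 2 * t * inner ℝ x (b.1 - x) + t ^ 2 * ‖b.1 - x‖ ^ 2
        + t * (b.2 - (m - ‖x‖ ^ 2)) := by
    intro t ht0 ht1
    have hxb := hx.const_sub b.1
    refine ge_of_tendsto (((hQlim.add ((hx.inner hxb).const_mul (2 * t))).add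
      ((hxb.norm.pow 2).const_mul (t ^ 2))).add ((hslim.const_sub b.2).const_mul t)) ?_
    exact Filter.Eventually.of_forall fun n => hseg _ (hqC n) _ hb t ht0 ht1
  have hfirst : 0 ≤ 2 * inner ℝ x (b.1 - x) + (b.2 - (m - ‖x‖ ^ 2)) := by
    refine le_of_forall_pos_le_add fun ε hε => ?_
    set t : ℝ := min 1 (ε / (‖b.1 - x‖ ^ 2 + 1)) with ht
    have ht0 : 0 < t := by positivity
    have h := hlim t ht0.le (min_le_left _ _)
    have htb : t * ‖b.1 - x‖ ^ 2 ≤ ε := by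
      have h1 : t ≤ ε / (‖b.1 - x‖ ^ 2 + 1) := min_le_right _ _
      rw [le_div_iff₀ (by positivity)] at h1
      nlinarith
    have h2 : 0 ≤ t * (2 * inner ℝ x (b.1 - x) + t * ‖b.1 - x‖ ^ 2
        + (b.2 - (m - ‖x‖ ^ 2))) := by nlinarith
    have := nonneg_of_mul_nonneg_right h2 ht0
    linarith
  rw [inner_sub_right, real_inner_self_eq_norm_sq] at hfirst
  linarith

/-- The balls with diameters `[y, -v]`, `(y, v)` running over a monotone set, have a common
point. -/
theorem exists_inner_nonpos_of_monotone [CompleteSpace H] {G : Set (H × H)}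
    (hG : ∀ a ∈ G, ∀ b ∈ G, 0 ≤ inner ℝ (a.1 - b.1) (a.2 - b.2)) :
    ∃ x : H, ∀ a ∈ G, inner ℝ (x - a.1) (x + a.2) ≤ 0 := by
  rcases G.eq_empty_or_nonempty with rfl | hne
  · exact ⟨0, by simp⟩
  set E : Set (H × H × ℝ) := (fun a : H × H => (a.1, a.2, inner ℝ a.1 a.2)) '' G with hE
  have hconv : ∀ b : H × H × ℝ, Convex ℝ {a : H × H × ℝ |
      inner ℝ a.1 b.2.1 + inner ℝ b.1 a.2.1 ≤ a.2.2 + b.2.2} := by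
    intro b a ha a' ha' s t hs ht hst
    simp only [Set.mem_ofPred_eq, Prod.fst_add, Prod.smul_fst, Prod.snd_add, Prod.smul_snd,
      inner_add_left, inner_add_right, inner_smul_left, inner_smul_right, smul_eq_mul,
      conj_trivial] at ha ha' ⊢
    have hb : b.2.2 = s * b.2.2 + t * b.2.2 := by rw [← add_mul, hst, one_mul]
    linarith [mul_le_mul_of_nonneg_left ha hs, mul_le_mul_of_nonneg_left ha' ht]
  have hE1 : ∀ a ∈ convexHull ℝ E, ∀ b ∈ E,
      inner ℝ a.1 b.2.1 + inner ℝ b.1 a.2.1 ≤ a.2.2 + b.2.2 := by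
    intro a ha b hb
    refine convexHull_min ?_ (hconv b) ha
    obtain ⟨b, hb, rfl⟩ := hb
    rintro _ ⟨a, ha, rfl⟩
    have h := hG a ha b hb
    simp only [inner_sub_left, inner_sub_right] at h
    simp only [Set.mem_ofPred_eq]
    linarith
  have hE2 : ∀ a ∈ convexHull ℝ E, inner ℝ a.1 a.2.1 ≤ a.2.2 := by
    intro a ha
    have h : a ∈ {b : H × H × ℝ | inner ℝ b.1 a.2.1 + inner ℝ a.1 b.2.1 ≤ b.2.2 + a.2.2} :=
      convexHull_min (fun b hb => by
        have := hE1 a ha b hb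
        simp only [Set.mem_ofPred_eq]
        linarith) (hconv a) ha
    simp only [Set.mem_ofPred_eq] at h
    linarith
  let Λ : (H × H × ℝ) →ₗ[ℝ] (H × ℝ) :=
    { toFun := fun a => ((1 / 2 : ℝ) • (a.1 - a.2.1), a.2.2)
      map_add' := fun a b => by
        ext
        · simp only [Prod.fst_add, Prod.snd_add, ← smul_add]
          congr 1
          abel
        · simp
      map_smul' := fun r a => by
        ext
        · simp [smul_sub, smul_comm r (2⁻¹ : ℝ)]
        · simp }
  obtain ⟨x, hx⟩ := exists_norm_sq_le_of_convex ((convex_convexHull ℝ E).linear_image Λ)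
    (((hne.image _).convexHull).image Λ) (by
      rintro _ ⟨a, ha, rfl⟩
      have h := hE2 a ha
      have e1 : ‖a.1 - a.2.1‖ ^ 2 = ‖a.1 + a.2.1‖ ^ 2 - 4 * inner ℝ a.1 a.2.1 := by
        rw [norm_sub_sq_real, norm_add_sq_real]
        ring
      have e2 : ‖(Λ a).1‖ ^ 2 = ‖a.1 - a.2.1‖ ^ 2 / 4 := by
        simp only [Λ, LinearMap.coe_mk, AddHom.coe_mk, norm_smul, mul_pow]
        norm_num
        ring
      have e3 : (Λ a).2 = a.2.2 := rfl
      rw [e2, e3, e1]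
      nlinarith [sq_nonneg ‖a.1 + a.2.1‖])
  refine ⟨x, fun a ha => ?_⟩
  have h := hx _ ⟨_, subset_convexHull ℝ E ⟨a, ha, rfl⟩, rfl⟩
  simp only [Λ, LinearMap.coe_mk, AddHom.coe_mk, inner_smul_right, inner_sub_right] at h
  simp only [inner_sub_left, inner_add_right, real_inner_self_eq_norm_sq]
  rw [real_inner_comm x a.1]
  linarith

/-- Minty's theorem: `I + cA` is surjective if `A` is maximal monotone and `c > 0`. -/
theorem IsMaximalMonotoneOp.exists_eq_add_smul [CompleteSpace H] {A : H → Set H}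
    (hA : IsMaximalMonotoneOp A) {c : ℝ} (hc : 0 < c) (z : H) :
    ∃ y, ∃ v ∈ A y, z = y + c • v := by
  obtain ⟨x, hx⟩ := exists_inner_nonpos_of_monotone
    (G := {a : H × H | ∃ v ∈ A a.1, a.2 = c • v - z}) (by
      rintro ⟨y, _⟩ ⟨v, hv, rfl⟩ ⟨y', _⟩ ⟨v', hv', rfl⟩
      have h := hA.1 y v y' v' hv hv'
      have e : c • v - z - (c • v' - z) = c • (v - v') := by rw [smul_sub]; abel
      simp only [e, inner_smul_right]
      positivity)
  set w : H := c⁻¹ • (z - x) with hw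
  have hcw : c • w = z - x := by rw [hw, smul_inv_smul₀ hc.ne']
  have hrel : ∀ y, ∀ v ∈ A y, 0 ≤ inner ℝ (x - y) (w - v) := by
    intro y v hv
    have h := hx (y, c • v - z) ⟨v, hv, rfl⟩
    have e : x + (c • v - z) = -(c • (w - v)) := by rw [smul_sub, hcw]; abel
    simp only [e, inner_neg_right, inner_smul_right] at h
    exact nonneg_of_mul_nonneg_right (by linarith) hc
  have hB := hA.2 (fun y => A y ∪ {v | y = x ∧ v = w}) (by
    rintro y v y' v' (hv | ⟨rfl, rfl⟩) (hv' | ⟨rfl, rfl⟩)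
    · exact hA.1 _ _ _ _ hv hv'
    · have h := hrel y v hv
      rwa [← neg_sub y, ← neg_sub v, inner_neg_neg] at h
    · exact hrel _ _ hv'
    · simp) (fun y => Set.subset_union_left)
  refine ⟨x, w, ?_, by rw [hcw]; abel⟩
  rw [← hB]
  exact Or.inr ⟨rfl, rfl⟩

theorem IsMaximalMonotoneOp.resolventOp_spec [CompleteSpace H] {A : H → Set H}
    (hA : IsMaximalMonotoneOp A) {c : ℝ} (hc : 0 < c) (z : H) :
    ∃ v ∈ A (resolventOp (scaleOp c A) z), z = resolventOp (scaleOp c A) z + c • v := by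
  obtain ⟨y, v, hv, hz⟩ := hA.exists_eq_add_smul hc z
  have hex : ∃ y, ∃ w ∈ scaleOp c A y, z = y + w := ⟨y, c • v, ⟨v, hv, rfl⟩, hz⟩
  obtain ⟨_, ⟨v, hv, rfl⟩, h⟩ := Classical.epsilon_spec hex
  exact ⟨v, hv, h⟩

theorem IsMonotoneOp.inner_nonneg_of_eq_add_smul {A : H → Set H} (hA : IsMonotoneOp A) {c : ℝ}
    (hc : 0 ≤ c) {z z' y y' v v' : H} (hv : v ∈ A y) (hv' : v' ∈ A y') (hz : z = y + c • v)
    (hz' : z' = y' + c • v') : 0 ≤ inner ℝ (y - y') ((z - z') - (y - y')) := by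
  have e : (z - z') - (y - y') = c • (v - v') := by rw [hz, hz', smul_sub]; abel
  rw [e, inner_smul_right]
  exact mul_nonneg hc (hA _ _ _ _ hv hv')

theorem IsMaximalMonotoneOp.resolventOp_eq [CompleteSpace H] {A : H → Set H}
    (hA : IsMaximalMonotoneOp A) {c : ℝ} (hc : 0 < c) {z y v : H} (hv : v ∈ A y)
    (hz : z = y + c • v) : resolventOp (scaleOp c A) z = y := by
  obtain ⟨v', hv', hz'⟩ := hA.resolventOp_spec hc z
  have h := hA.1.inner_nonneg_of_eq_add_smul hc.le hv' hv hz' hz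
  rw [sub_self, zero_sub, inner_neg_right, real_inner_self_eq_norm_sq] at h
  have h0 : ‖resolventOp (scaleOp c A) z - y‖ ^ 2 = 0 := le_antisymm (by linarith) (by positivity)
  exact sub_eq_zero.mp (norm_eq_zero.mp (pow_eq_zero_iff (two_ne_zero) |>.mp h0))

/-! ### The forward-backward operator -/

/-- The forward-backward operator `J_{cU₁} ∘ (I - cU₂)`. -/
noncomputable def forwardBackward (U₁ : H → Set H) (U₂ : H → H) (c : ℝ) (y : H) : H :=
  resolventOp (scaleOp c U₁) (y - c • U₂ y)

/-- The operator `S` with `forwardBackward = (1 - a) I + a S` for `a = 2δ / (4δ - c)`. -/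
noncomputable def forwardBackwardRelax (U₁ : H → Set H) (U₂ : H → H) (δ c : ℝ) (y : H) : H :=
  y + ((4 * δ - c) / (2 * δ)) • (forwardBackward U₁ U₂ c y - y)

theorem forwardBackward_eq_self_iff [CompleteSpace H] {U₁ : H → Set H}
    (hU₁ : IsMaximalMonotoneOp U₁) (U₂ : H → H) {c : ℝ} (hc : 0 < c) (y : H) :
    forwardBackward U₁ U₂ c y = y ↔ y ∈ zer (addOp U₁ U₂) := by
  constructor
  · intro h
    obtain ⟨v, hv, hz⟩ := hU₁.resolventOp_spec hc (y - c • U₂ y)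
    change _ = forwardBackward U₁ U₂ c y + _ at hz
    change v ∈ U₁ (forwardBackward U₁ U₂ c y) at hv
    rw [h] at hv hz
    refine ⟨v, hv, ?_⟩
    have e : c • (v + U₂ y) = 0 := by
      rw [smul_add]
      have : c • v = -(c • U₂ y) := by
        rw [sub_eq_add_neg] at hz
        exact (add_left_cancel hz).symm
      rw [this]
      abel
    exact ((smul_eq_zero.mp e).resolve_left hc.ne').symm
  · rintro ⟨v, hv, h0⟩
    refine hU₁.resolventOp_eq hc hv ?_
    have : U₂ y = -v := (neg_eq_of_add_eq_zero_right h0.symm).symm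
    rw [this, smul_neg, sub_neg_eq_add]

theorem forwardBackwardRelax_eq_self_iff [CompleteSpace H] {U₁ : H → Set H}
    (hU₁ : IsMaximalMonotoneOp U₁) (U₂ : H → H) {δ c : ℝ} (hδ : 0 < δ) (hc : c ∈ Set.Ioc 0 (2 * δ))
    (y : H) : forwardBackwardRelax U₁ U₂ δ c y = y ↔ y ∈ zer (addOp U₁ U₂) := by
  rw [← forwardBackward_eq_self_iff hU₁ U₂ hc.1]
  have hne : (4 * δ - c) / (2 * δ) ≠ 0 := by
    have := hc.2
    have : 0 < 4 * δ - c := by linarith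
    positivity
  rw [forwardBackwardRelax, add_eq_left, smul_eq_zero, or_iff_right hne, sub_eq_zero]

/-- The forward-backward operator is `2δ / (4δ - c)`-averaged. -/
theorem norm_forwardBackwardRelax_sub_le [CompleteSpace H] {U₁ : H → Set H}
    (hU₁ : IsMaximalMonotoneOp U₁) {U₂ : H → H} {δ c : ℝ} (hδ : 0 < δ) (hU₂ : IsCocoercive δ U₂)
    (hc : c ∈ Set.Ioc 0 (2 * δ)) (y z : H) :
    ‖forwardBackwardRelax U₁ U₂ δ c y - forwardBackwardRelax U₁ U₂ δ c z‖ ≤ ‖y - z‖ := by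
  set Ty := forwardBackward U₁ U₂ c y with hTy
  set Tz := forwardBackward U₁ U₂ c z with hTz
  obtain ⟨v, hv, hvy⟩ := hU₁.resolventOp_spec hc.1 (y - c • U₂ y)
  obtain ⟨w, hw, hwz⟩ := hU₁.resolventOp_spec hc.1 (z - c • U₂ z)
  have hmon := hU₁.1.inner_nonneg_of_eq_add_smul hc.1.le hv hw hvy hwz
  change 0 ≤ inner ℝ (Ty - Tz) _ at hmon
  have hco := hU₂ y z
  set κ := (4 * δ - c) / (2 * δ) with hκ
  set d := y - z with hd
  set e := U₂ y - U₂ z with he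
  set r := (y - Ty) - (z - Tz) with hr
  have e1 : Ty - Tz = d - r := by rw [hd, hr]; abel
  have e2 : (y - c • U₂ y - (z - c • U₂ z)) - (Ty - Tz) = r - c • e := by
    rw [hr, he, smul_sub]; abel
  change 0 ≤ inner ℝ (Ty - Tz) ((y - c • U₂ y - (z - c • U₂ z)) - (Ty - Tz)) at hmon
  rw [e2, e1] at hmon
  simp only [inner_sub_left, inner_sub_right, inner_smul_right, real_inner_self_eq_norm_sq] at hmon
  -- Completing the square absorbs the mixed term into the cocoercivity bound.
  have hsq : 0 ≤ ‖r‖ ^ 2 - 4 * δ * inner ℝ r e + 4 * δ ^ 2 * ‖e‖ ^ 2 := by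
    have h : 0 ≤ ‖r - (2 * δ) • e‖ ^ 2 := by positivity
    rw [norm_sub_sq_real, inner_smul_right, norm_smul, mul_pow, Real.norm_eq_abs, sq_abs] at h
    linarith
  have hkey : κ * ‖r‖ ^ 2 ≤ 2 * inner ℝ d r := by
    rw [hκ, div_mul_eq_mul_div, div_le_iff₀ (by positivity)]
    have h1 := mul_le_mul_of_nonneg_left hco hc.1.le
    have h2 := mul_nonneg hc.1.le hsq
    nlinarith [mul_le_mul_of_nonneg_left h1 hδ.le, mul_nonneg hδ.le hmon]
  have hκ0 : 0 ≤ κ := by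
    have := hc.2
    have : 0 < 4 * δ - c := by linarith
    positivity
  have e3 : forwardBackwardRelax U₁ U₂ δ c y - forwardBackwardRelax U₁ U₂ δ c z = d - κ • r := by
    simp only [forwardBackwardRelax, ← hκ, ← hTy, ← hTz]
    rw [hd, hr, smul_sub, smul_sub, smul_sub, smul_sub, smul_sub]
    abel
  rw [e3]
  refine le_of_sq_le_sq ?_ (norm_nonneg _)
  rw [norm_sub_sq_real, inner_smul_right, norm_smul, mul_pow, Real.norm_eq_abs, sq_abs]
  nlinarith [mul_le_mul_of_nonneg_left hkey hκ0]

end Operators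

/-! ### A recursive inequality -/

/-- Unrolling `s (i + 1) ≤ (1 - a i) s i + b i`, with `1 - a ≤ exp (-a)`. -/
theorem le_exp_neg_sum_add_sum {s a b : ℕ → ℝ} {D : ℝ} {k : ℕ} (hD : 0 ≤ D) (hsD : s k ≤ D)
    (ha : ∀ i, a i ∈ Set.Icc (0 : ℝ) 1) {n : ℕ}
    (hb : ∀ i ∈ Finset.Ico k (k + n), 0 ≤ b i)
    (hs : ∀ i ∈ Finset.Ico k (k + n), s (i + 1) ≤ (1 - a i) * s i + b i) :
    s (k + n) ≤ D * Real.exp (-∑ i ∈ Finset.Ico k (k + n), a i)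
      + ∑ i ∈ Finset.Ico k (k + n), b i := by
  induction n with
  | zero => simpa using hsD
  | succ n ih =>
    have hsub : Finset.Ico k (k + n) ⊆ Finset.Ico k (k + (n + 1)) :=
      Finset.Ico_subset_Ico_right (by omega)
    have hmem : k + n ∈ Finset.Ico k (k + (n + 1)) := Finset.mem_Ico.mpr ⟨by omega, by omega⟩
    have h1 := ih (fun i hi => hb i (hsub hi)) (fun i hi => hs i (hsub hi))
    have h2 := hs _ hmem
    have hB : 0 ≤ ∑ i ∈ Finset.Ico k (k + n), b i :=
      Finset.sum_nonneg fun i hi => hb i (hsub hi)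
    obtain ⟨ha0, ha1⟩ := ha (k + n)
    rw [← add_assoc, Finset.sum_Ico_succ_top (by omega), Finset.sum_Ico_succ_top (by omega),
      neg_add, Real.exp_add]
    set X := Real.exp (-∑ i ∈ Finset.Ico k (k + n), a i)
    have hX : 0 ≤ D * X := mul_nonneg hD (Real.exp_pos _).le
    have h3 : 1 - a (k + n) ≤ Real.exp (-a (k + n)) := by
      have := Real.add_one_le_exp (-a (k + n))
      linarith
    have h4 := mul_le_mul_of_nonneg_left h1 (sub_nonneg.mpr ha1)
    have h5 := mul_le_mul_of_nonneg_left h3 hX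
    nlinarith [mul_nonneg ha0 hB]

/-- As the terms are at most `1`, skipping the first `k` of them costs at most `k`. -/
theorem IsMonotoneRateOfDivergence.le_sum_Ico {a : ℕ → ℝ} {A : ℕ → ℕ}
    (hA : IsMonotoneRateOfDivergence a A) (ha : ∀ i, a i ∈ Set.Icc (0 : ℝ) 1) {k l m : ℕ}
    (hm : A (k + l) + 1 ≤ m) : (l : ℝ) ≤ ∑ i ∈ Finset.Ico k m, a i ∧ k ≤ m := by
  have hge : ((k + l : ℕ) : ℝ) ≤ ∑ i ∈ Finset.range m, a i := by
    refine (hA.1 (k + l)).trans (Finset.sum_le_sum_of_subset_of_nonneg ?_ fun i _ _ => (ha i).1)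
    intro i hi
    simp only [Finset.mem_Icc, Finset.mem_range] at hi ⊢
    omega
  have hle : ∀ j, ∑ i ∈ Finset.range j, a i ≤ j := fun j => by
    simpa using Finset.sum_le_sum (s := Finset.range j) fun i _ => (ha i).2
  have hkm : k ≤ m := by
    have h : ((k + l : ℕ) : ℝ) ≤ (m : ℕ) := hge.trans (hle m)
    have : k + l ≤ m := by exact_mod_cast h
    omega
  refine ⟨?_, hkm⟩
  rw [Finset.sum_Ico_eq_sub _ hkm]
  push_cast at hge
  linarith [hle k]

theorem mul_exp_neg_le_of_log_le {D ε t : ℝ} (hD : 0 < D) (hε : 0 < ε)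
    (ht : Real.log (D / ε) ≤ t) : D * Real.exp (-t) ≤ ε := by
  have h := Real.exp_le_exp.mpr ht
  rw [Real.exp_log (by positivity), div_le_iff₀ hε] at h
  rw [Real.exp_neg, ← div_eq_mul_inv, div_le_iff₀ (Real.exp_pos _)]
  linarith

/-- Quantitative form of Xu's lemma with summable perturbations. -/
theorem le_of_thetaHat_le {s a b : ℕ → ℝ} {A : ℕ → ℕ} {V : ℝ → ℕ} {D : ℕ} (hD : 0 < D)
    (ha : ∀ i, a i ∈ Set.Icc (0 : ℝ) 1) (hA : IsMonotoneRateOfDivergence a A)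
    (hb : ∀ i, 0 ≤ b i)
    (hV : ∀ ε, 0 < ε → ∀ n, ∑ i ∈ Finset.Icc (V ε + 1) (V ε + n), b i ≤ ε)
    (hsD : ∀ n, s n ≤ D) (hs : ∀ n, s (n + 1) ≤ (1 - a n) * s n + b n)
    {ε : ℝ} (hε : 0 < ε) {n : ℕ} (hn : thetaHat A V D ε ≤ n) : s n ≤ ε := by
  rw [thetaHat, show V (ε / 2) + ⌈Real.log (2 * (D : ℝ) / ε)⌉₊ + 1
    = (V (ε / 2) + 1) + ⌈Real.log (2 * (D : ℝ) / ε)⌉₊ by ring] at hn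
  obtain ⟨hsum, hle⟩ := hA.le_sum_Ico ha hn
  obtain ⟨j, rfl⟩ := Nat.exists_eq_add_of_le hle
  have hD' : (0 : ℝ) < D := by exact_mod_cast hD
  have h := le_exp_neg_sum_add_sum (n := j) hD'.le (hsD (V (ε / 2) + 1)) ha
    (fun i _ => hb i) (fun i _ => hs i)
  have h1 : (D : ℝ) * Real.exp (-∑ i ∈ Finset.Ico (V (ε / 2) + 1) (V (ε / 2) + 1 + j), a i)
      ≤ ε / 2 := by
    refine mul_exp_neg_le_of_log_le hD' (by positivity) (le_trans ?_ hsum)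
    rw [div_div_eq_mul_div, mul_comm (D : ℝ)]
    exact Nat.le_ceil _
  have h2 := hV (ε / 2) (by positivity) j
  have h3 : Finset.Icc (V (ε / 2) + 1) (V (ε / 2) + j)
      = Finset.Ico (V (ε / 2) + 1) (V (ε / 2) + 1 + j) := by
    ext i
    simp only [Finset.mem_Icc, Finset.mem_Ico]
    omega
  rw [h3] at h2
  linarith

/-! ### The Halpern–Mann iteration of a nonexpansive map -/

theorem norm_sub_le_two_mul {E : Type*} [SeminormedAddCommGroup E] {y z p : E} {r : ℝ}
    (hy : ‖y - p‖ ≤ r) (hz : ‖z - p‖ ≤ r) :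
    ‖y - z‖ ≤ 2 * r := by
  have := norm_sub_le_norm_sub_add_norm_sub y p z
  rw [norm_sub_rev p z] at this
  linarith

variable {H : Type*} [NormedAddCommGroup H] [InnerProductSpace ℝ H]

/-- Strong convexity identity of the squared norm. -/
theorem norm_lineMap_sq (t : ℝ) (a b : H) :
    ‖(1 - t) • a + t • b‖ ^ 2 = (1 - t) * ‖a‖ ^ 2 + t * ‖b‖ ^ 2 - t * (1 - t) * ‖a - b‖ ^ 2 := by
  rw [norm_add_sq_real, norm_sub_sq_real, norm_smul, norm_smul, inner_smul_left, inner_smul_right,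
    mul_pow, mul_pow, Real.norm_eq_abs, Real.norm_eq_abs, sq_abs, sq_abs, conj_trivial]
  ring

theorem norm_lineMap_le {t r : ℝ} (ht : t ∈ Set.Icc (0 : ℝ) 1) {a b : H} (ha : ‖a‖ ≤ r)
    (hb : ‖b‖ ≤ r) : ‖(1 - t) • a + t • b‖ ≤ r := by
  refine (norm_add_le _ _).trans ?_
  rw [norm_smul, norm_smul, Real.norm_eq_abs, Real.norm_eq_abs, abs_of_nonneg ht.1,
    abs_of_nonneg (sub_nonneg.mpr ht.2)]
  nlinarith [mul_le_mul_of_nonneg_left ha (sub_nonneg.mpr ht.2),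
    mul_le_mul_of_nonneg_left hb ht.1]

/-- The sequence `x` alternates Halpern steps anchored at `u` with Mann steps of the nonexpansive
map `S`, which fixes `p`; the weights of the Mann steps stay in `[g, 1 - g]`, and `N` bounds
`‖x 0 - p‖` and `2 ‖u - p‖`. -/
structure IsHalpernMann (S : H → H) (α β : ℕ → ℝ) (u p : H) (x : ℕ → H) (N : ℕ) (g : ℝ) :
    Prop where
  nonexpansive : ∀ y z, ‖S y - S z‖ ≤ ‖y - z‖
  fixed : S p = p
  halpern : ∀ n, x (2 * n + 1) = (1 - α n) • x (2 * n) + α n • u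
  mann : ∀ n, x (2 * n + 2) = (1 - β n) • S (x (2 * n + 1)) + β n • x (2 * n + 1)
  mem_alpha : ∀ n, α n ∈ Set.Icc (0 : ℝ) 1
  mem_beta : ∀ n, β n ∈ Set.Icc g (1 - g)
  pos_g : 0 < g
  pos_N : 0 < N
  norm_init : ‖x 0 - p‖ ≤ N
  norm_anchor : 2 * ‖u - p‖ ≤ N

namespace IsHalpernMann

variable {S : H → H} {α β : ℕ → ℝ} {u p : H} {x : ℕ → H} {N : ℕ} {g : ℝ}

theorem mem_Icc_beta (h : IsHalpernMann S α β u p x N g) (n : ℕ) : β n ∈ Set.Icc (0 : ℝ) 1 := by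
  have h1 := (h.mem_beta n).1
  have h2 := (h.mem_beta n).2
  have h3 := h.pos_g
  exact ⟨by linarith, by linarith⟩

theorem one_le_N (h : IsHalpernMann S α β u p x N g) : (1 : ℝ) ≤ N := by
  exact_mod_cast h.pos_N

theorem norm_S_sub_le (h : IsHalpernMann S α β u p x N g) (y : H) : ‖S y - p‖ ≤ ‖y - p‖ := by
  simpa only [h.fixed] using h.nonexpansive y p

theorem halpern_sub (h : IsHalpernMann S α β u p x N g) (n : ℕ) (z : H) :
    x (2 * n + 1) - z = (1 - α n) • (x (2 * n) - z) + α n • (u - z) := by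
  rw [h.halpern, smul_sub, smul_sub, sub_smul, sub_smul]
  simp only [one_smul]
  abel

theorem mann_sub (h : IsHalpernMann S α β u p x N g) (n : ℕ) (z : H) :
    x (2 * n + 2) - z = (1 - β n) • (S (x (2 * n + 1)) - z) + β n • (x (2 * n + 1) - z) := by
  rw [h.mann, smul_sub, smul_sub, sub_smul, sub_smul]
  simp only [one_smul]
  abel

theorem norm_even_and_odd (h : IsHalpernMann S α β u p x N g) (n : ℕ) :
    ‖x (2 * n) - p‖ ≤ N ∧ ‖x (2 * n + 1) - p‖ ≤ N := by
  have hu : ‖u - p‖ ≤ N := by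
    have := h.norm_anchor
    have := norm_nonneg (u - p)
    linarith
  have step : ∀ n, ‖x (2 * n) - p‖ ≤ N → ‖x (2 * n + 1) - p‖ ≤ N := fun n hn => by
    rw [h.halpern_sub]
    exact norm_lineMap_le (h.mem_alpha n) hn hu
  induction n with
  | zero => exact ⟨h.norm_init, step 0 h.norm_init⟩
  | succ n ih =>
    have h1 : ‖x (2 * (n + 1)) - p‖ ≤ N := by
      rw [show 2 * (n + 1) = 2 * n + 2 by ring, h.mann_sub]
      exact norm_lineMap_le (h.mem_Icc_beta n) ((h.norm_S_sub_le _).trans ih.2) ih.2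
    exact ⟨h1, step _ h1⟩

theorem norm_sub_le (h : IsHalpernMann S α β u p x N g) (n : ℕ) : ‖x n - p‖ ≤ N := by
  rcases Nat.even_or_odd' n with ⟨m, rfl | rfl⟩
  · exact (h.norm_even_and_odd m).1
  · exact (h.norm_even_and_odd m).2

theorem norm_anchor_sub_le (h : IsHalpernMann S α β u p x N g) {z : H} (hz : ‖z - p‖ ≤ N) :
    ‖u - z‖ ≤ 3 / 2 * N := by
  have := norm_sub_le_norm_sub_add_norm_sub u p z
  rw [norm_sub_rev p z] at this
  have := h.norm_anchor
  linarith

/-! ### Asymptotic regularity -/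

theorem norm_even_succ_sub_le (h : IsHalpernMann S α β u p x N g) (n : ℕ) :
    ‖x (2 * (n + 1) + 2) - x (2 * (n + 1))‖ ≤ (1 - α (n + 1)) * ‖x (2 * n + 2) - x (2 * n)‖
      + 2 * N * (|α (n + 1) - α n| + |β (n + 1) - β n|) := by
  have hα : ‖x (2 * (n + 1) + 1) - x (2 * n + 1)‖
      ≤ (1 - α (n + 1)) * ‖x (2 * n + 2) - x (2 * n)‖ + 2 * N * |α (n + 1) - α n| := by
    have e : x (2 * (n + 1) + 1) - x (2 * n + 1)
        = (1 - α (n + 1)) • (x (2 * n + 2) - x (2 * n)) + (α (n + 1) - α n) • (u - x (2 * n)) := by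
      rw [h.halpern (n + 1), h.halpern n, show 2 * (n + 1) = 2 * n + 2 by ring]
      module
    rw [e]
    refine (norm_add_le _ _).trans ?_
    rw [norm_smul, norm_smul, Real.norm_eq_abs, Real.norm_eq_abs,
      abs_of_nonneg (sub_nonneg.mpr (h.mem_alpha (n + 1)).2)]
    have h1 := h.norm_anchor_sub_le (h.norm_sub_le (2 * n))
    have h2 := h.one_le_N
    have h3 := mul_le_mul_of_nonneg_right h1 (abs_nonneg (α (n + 1) - α n))
    nlinarith [abs_nonneg (α (n + 1) - α n)]
  have hβ : ‖x (2 * (n + 1) + 2) - x (2 * n + 2)‖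
      ≤ ‖x (2 * (n + 1) + 1) - x (2 * n + 1)‖ + 2 * N * |β (n + 1) - β n| := by
    have e : x (2 * (n + 1) + 2) - x (2 * n + 2)
        = ((1 - β (n + 1)) • (S (x (2 * (n + 1) + 1)) - S (x (2 * n + 1)))
            + β (n + 1) • (x (2 * (n + 1) + 1) - x (2 * n + 1)))
          + (β (n + 1) - β n) • (x (2 * n + 1) - S (x (2 * n + 1))) := by
      rw [h.mann (n + 1), h.mann n]
      module
    rw [e]
    refine (norm_add_le _ _).trans (add_le_add
      (norm_lineMap_le (h.mem_Icc_beta _) (h.nonexpansive _ _) le_rfl) ?_)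
    rw [norm_smul, Real.norm_eq_abs, mul_comm]
    have h1 := norm_sub_le_two_mul (h.norm_sub_le (2 * n + 1))
      ((h.norm_S_sub_le _).trans (h.norm_sub_le (2 * n + 1)))
    gcongr
  rw [show x (2 * (n + 1)) = x (2 * n + 2) by rfl]
  linarith

theorem norm_even_sub_le_of_theta1_le (h : IsHalpernMann S α β u p x N g) {Γ₂ : ℕ → ℕ}
    {Γ₃ Γ₄ : ℝ → ℕ} (hΓ₂ : IsMonotoneRateOfDivergence α Γ₂)
    (hΓ₃ : IsMonotoneCauchyRateOfVariation α Γ₃) (hΓ₄ : IsMonotoneCauchyRateOfVariation β Γ₄)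
    {ε : ℝ} (hε : 0 < ε) {n : ℕ} (hn : theta1 N Γ₂ Γ₃ Γ₄ ε ≤ n) :
    ‖x (2 * n + 2) - x (2 * n)‖ ≤ ε := by
  have hN := h.one_le_N
  -- Dropping the term `α 0 ≤ 1` costs the shift by one in the rate of divergence.
  have hdiv : IsMonotoneRateOfDivergence (fun i => α (i + 1)) (fun k => Γ₂ (k + 1)) := by
    refine ⟨fun k => ?_, fun k k' hk => hΓ₂.2 _ _ (by omega)⟩
    have h1 := hΓ₂.1 (k + 1)
    have h2 : ∑ i ∈ Finset.Icc 0 (Γ₂ (k + 1)), α i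
        ≤ ∑ i ∈ Finset.Icc 0 (Γ₂ (k + 1)), α (i + 1) + 1 := by
      rw [← Nat.range_succ_eq_Icc_zero]
      have h3 := Finset.sum_range_succ' α (Γ₂ (k + 1) + 1)
      rw [Finset.sum_range_succ] at h3
      linarith [(h.mem_alpha 0).2, (h.mem_alpha (Γ₂ (k + 1) + 1)).1]
    push_cast at h1
    linarith
  refine le_of_thetaHat_le (s := fun n => ‖x (2 * n + 2) - x (2 * n)‖)
    (b := fun n => 2 * N * (|α (n + 1) - α n| + |β (n + 1) - β n|))
    (by have := h.pos_N; omega) (fun i => h.mem_alpha (i + 1)) hdiv (fun i => by positivity)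
    ?_ ?_ h.norm_even_succ_sub_le hε hn
  · intro η hη k
    set V := max (Γ₃ (η / (4 * (N : ℝ)))) (Γ₄ (η / (4 * (N : ℝ)))) with hV
    have hη' : 0 < η / (4 * (N : ℝ)) := by positivity
    have htail : ∀ (a : ℕ → ℝ) (Γ : ℝ → ℕ), IsMonotoneCauchyRateOfVariation a Γ →
        Γ (η / (4 * (N : ℝ))) ≤ V →
        ∑ i ∈ Finset.Icc (V + 1) (V + k), |a (i + 1) - a i| ≤ η / (4 * (N : ℝ)) := by
      intro a Γ hΓ hle
      refine le_trans (Finset.sum_le_sum_of_subset_of_nonneg ?_ fun i _ _ => abs_nonneg _)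
        (hΓ.1 _ hη' (V + k))
      exact Finset.Icc_subset_Icc (by omega) (by omega)
    have h3 := htail α Γ₃ hΓ₃ (le_max_left _ _)
    have h4 := htail β Γ₄ hΓ₄ (le_max_right _ _)
    rw [← Finset.mul_sum, Finset.sum_add_distrib]
    calc _ ≤ 2 * (N : ℝ) * (η / (4 * N) + η / (4 * N)) := by gcongr
      _ = η := by field_simp; norm_num
  · intro n
    push_cast
    exact norm_sub_le_two_mul (h.norm_sub_le _) (h.norm_sub_le _)

section Rates

variable {Γ₁ : ℝ → ℕ} {Γ₂ : ℕ → ℕ} {Γ₃ Γ₄ : ℝ → ℕ}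

/-- A full step decreases `‖· - p‖²` by `β (1 - β) ‖S y - y‖²`, up to a multiple of `α`; as
consecutive even terms are close, `‖S y - y‖` is small. -/
theorem norm_S_odd_sub_le_of_theta3_le (h : IsHalpernMann S α β u p x N g)
    (hΓ₁ : IsMonotoneRateToZero α Γ₁) (hΓ₂ : IsMonotoneRateOfDivergence α Γ₂)
    (hΓ₃ : IsMonotoneCauchyRateOfVariation α Γ₃) (hΓ₄ : IsMonotoneCauchyRateOfVariation β Γ₄)
    {ε : ℝ} (hε : 0 < ε) {n : ℕ} (hn : theta3 N g Γ₁ Γ₂ Γ₃ Γ₄ ε ≤ n) :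
    ‖S (x (2 * n + 1)) - x (2 * n + 1)‖ ≤ ε := by
  have hN := h.one_le_N
  have hg := h.pos_g
  have h1 := h.norm_even_sub_le_of_theta1_le hΓ₂ hΓ₃ hΓ₄ (by positivity)
    ((le_max_left _ _).trans hn)
  have h2 := hΓ₁.1 _ (by positivity) n ((le_max_right _ _).trans hn)
  rw [abs_of_nonneg (h.mem_alpha n).1, le_div_iff₀ (by positivity)] at h2
  rw [le_div_iff₀ (by positivity)] at h1
  set y := x (2 * n + 1) with hy
  have hmann : ‖x (2 * n + 2) - p‖ ^ 2 ≤ ‖y - p‖ ^ 2 - g ^ 2 * ‖S y - y‖ ^ 2 := by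
    rw [h.mann_sub n p, norm_lineMap_sq, ← hy, sub_sub_sub_cancel_right]
    obtain ⟨hb1, hb2⟩ := h.mem_beta n
    have h3 : ‖S y - p‖ ^ 2 ≤ ‖y - p‖ ^ 2 := by
      have := h.norm_S_sub_le y
      gcongr
    have h4 : g ^ 2 ≤ β n * (1 - β n) := by nlinarith
    have h5 := mul_le_mul_of_nonneg_left h3 (sub_nonneg.mpr (h.mem_Icc_beta n).2)
    have h6 := mul_le_mul_of_nonneg_right h4 (sq_nonneg ‖S y - y‖)
    linarith
  have hhal : ‖y - p‖ ^ 2 ≤ ‖x (2 * n) - p‖ ^ 2 + α n * (N ^ 2 / 4) := by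
    obtain ⟨ha0, ha1⟩ := h.mem_alpha n
    rw [hy, h.halpern_sub n p, norm_lineMap_sq]
    have h3 : ‖u - p‖ ^ 2 ≤ N ^ 2 / 4 := by
      have := h.norm_anchor
      nlinarith [norm_nonneg (u - p)]
    have h4 := mul_le_mul_of_nonneg_left h3 ha0
    have h5 := mul_nonneg (mul_nonneg ha0 (sub_nonneg.mpr ha1))
      (sq_nonneg ‖x (2 * n) - p - (u - p)‖)
    have h6 := mul_nonneg ha0 (sq_nonneg ‖x (2 * n) - p‖)
    linarith
  have hdiff : ‖x (2 * n) - p‖ ^ 2 - ‖x (2 * n + 2) - p‖ ^ 2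
      ≤ 2 * N * ‖x (2 * n + 2) - x (2 * n)‖ := by
    have h3 := norm_sub_le_norm_sub_add_norm_sub (x (2 * n)) (x (2 * n + 2)) p
    rw [norm_sub_rev (x (2 * n)) (x (2 * n + 2))] at h3
    have h4 := h.norm_sub_le (2 * n)
    have h5 := h.norm_sub_le (2 * n + 2)
    have h6 : (‖x (2 * n) - p‖ - ‖x (2 * n + 2) - p‖) * (‖x (2 * n) - p‖ + ‖x (2 * n + 2) - p‖)
        ≤ ‖x (2 * n + 2) - x (2 * n)‖ * (2 * N) := by
      refine mul_le_mul (by linarith) (by linarith) (by positivity) (norm_nonneg _)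
    linarith
  have hsq : (g * ‖S y - y‖) ^ 2 ≤ (g * ε) ^ 2 := by
    nlinarith [sq_nonneg (g * ε)]
  have := le_of_sq_le_sq hsq (by positivity)
  exact le_of_mul_le_mul_left this hg

theorem norm_odd_sub_even_le_of_theta4_le (h : IsHalpernMann S α β u p x N g)
    (hΓ₁ : IsMonotoneRateToZero α Γ₁) (hΓ₂ : IsMonotoneRateOfDivergence α Γ₂)
    (hΓ₃ : IsMonotoneCauchyRateOfVariation α Γ₃) (hΓ₄ : IsMonotoneCauchyRateOfVariation β Γ₄)
    {ε : ℝ} (hε : 0 < ε) {n : ℕ} (hn : theta4 N g Γ₁ Γ₂ Γ₃ Γ₄ ε ≤ n) :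
    ‖x (2 * n + 1) - x (2 * n)‖ ≤ ε := by
  have h1 := h.norm_even_sub_le_of_theta1_le hΓ₂ hΓ₃ hΓ₄ (half_pos hε)
    ((le_max_left _ _).trans hn)
  have h2 := h.norm_S_odd_sub_le_of_theta3_le hΓ₁ hΓ₂ hΓ₃ hΓ₄ (half_pos hε)
    ((le_max_right _ _).trans hn)
  have h3 : ‖x (2 * n + 2) - x (2 * n + 1)‖ ≤ ε / 2 := by
    rw [h.mann_sub n (x (2 * n + 1))]
    exact norm_lineMap_le (h.mem_Icc_beta n) h2 (by simpa using (half_pos hε).le)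
  have h4 := norm_sub_le_norm_sub_add_norm_sub (x (2 * n + 1)) (x (2 * n + 2)) (x (2 * n))
  rw [norm_sub_rev (x (2 * n + 1)) (x (2 * n + 2))] at h4
  linarith

theorem norm_S_sub_le_of_rho_le (h : IsHalpernMann S α β u p x N g)
    (hΓ₁ : IsMonotoneRateToZero α Γ₁) (hΓ₂ : IsMonotoneRateOfDivergence α Γ₂)
    (hΓ₃ : IsMonotoneCauchyRateOfVariation α Γ₃) (hΓ₄ : IsMonotoneCauchyRateOfVariation β Γ₄)
    {ε : ℝ} (hε : 0 < ε) {n : ℕ} (hn : rho N g Γ₁ Γ₂ Γ₃ Γ₄ ε ≤ n) : ‖S (x n) - x n‖ ≤ ε := by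
  have hn2 : rho2 N g Γ₁ Γ₂ Γ₃ Γ₄ ε ≤ n := (le_max_left _ _).trans hn
  rw [rho2] at hn2
  have hodd : ∀ m, theta3 N g Γ₁ Γ₂ Γ₃ Γ₄ (ε / 3) ≤ m →
      ‖S (x (2 * m + 1)) - x (2 * m + 1)‖ ≤ ε / 3 := fun m hm =>
    h.norm_S_odd_sub_le_of_theta3_le hΓ₁ hΓ₂ hΓ₃ hΓ₄ (by positivity) hm
  rcases Nat.even_or_odd' n with ⟨m, rfl | rfl⟩
  · obtain ⟨m, rfl⟩ : ∃ l, m = l + 1 := ⟨m - 1, by omega⟩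
    have h1 := hodd m (by omega)
    rw [show 2 * (m + 1) = 2 * m + 2 by ring]
    set y := x (2 * m + 1) with hy
    have h2 : ‖x (2 * m + 2) - y‖ ≤ ε / 3 := by
      rw [h.mann_sub m]
      exact norm_lineMap_le (h.mem_Icc_beta m) h1 (by rw [sub_self, norm_zero]; positivity)
    have h3 := h.nonexpansive (x (2 * m + 2)) y
    have h4 := norm_sub_le_norm_sub_add_norm_sub (S (x (2 * m + 2))) (S y) (x (2 * m + 2))
    have h5 := norm_sub_le_norm_sub_add_norm_sub (S y) y (x (2 * m + 2))
    rw [norm_sub_rev y (x (2 * m + 2))] at h5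
    linarith
  · have := hodd m (by omega)
    linarith

end Rates

end IsHalpernMann

/-! ### Monotonicity of the rates -/

section Antitone

variable {N : ℕ} {g : ℝ} {Γ₁ : ℝ → ℕ} {Γ₂ : ℕ → ℕ} {Γ₃ Γ₄ : ℝ → ℕ}

theorem theta1_anti (hN : 0 < N) (hΓ₂ : Monotone Γ₂) (hΓ₃ : ∀ ε ε', 0 < ε → ε ≤ ε' → Γ₃ ε' ≤ Γ₃ ε)
    (hΓ₄ : ∀ ε ε', 0 < ε → ε ≤ ε' → Γ₄ ε' ≤ Γ₄ ε) {ε ε' : ℝ} (hε : 0 < ε) (hle : ε ≤ ε') :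
    theta1 N Γ₂ Γ₃ Γ₄ ε' ≤ theta1 N Γ₂ Γ₃ Γ₄ ε := by
  have hN' : (0 : ℝ) < N := by exact_mod_cast hN
  have hε' : 0 < ε' := hε.trans_le hle
  have hV : ε / 2 / (4 * (N : ℝ)) ≤ ε' / 2 / (4 * N) := by gcongr
  have hlog : ⌈Real.log (2 * ((2 * N : ℕ) : ℝ) / ε')⌉₊
      ≤ ⌈Real.log (2 * ((2 * N : ℕ) : ℝ) / ε)⌉₊ := by
    push_cast
    gcongr
  have h3 := hΓ₃ _ _ (by positivity) hV
  have h4 := hΓ₄ _ _ (by positivity) hV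
  simp only [theta1, thetaHat]
  refine Nat.add_le_add_right (hΓ₂ ?_) 1
  gcongr

theorem theta3_anti (hN : 0 < N) (hg : 0 < g) (hΓ₁ : ∀ ε ε', 0 < ε → ε ≤ ε' → Γ₁ ε' ≤ Γ₁ ε)
    (hΓ₂ : Monotone Γ₂) (hΓ₃ : ∀ ε ε', 0 < ε → ε ≤ ε' → Γ₃ ε' ≤ Γ₃ ε)
    (hΓ₄ : ∀ ε ε', 0 < ε → ε ≤ ε' → Γ₄ ε' ≤ Γ₄ ε) {ε ε' : ℝ} (hε : 0 < ε) (hle : ε ≤ ε') :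
    theta3 N g Γ₁ Γ₂ Γ₃ Γ₄ ε' ≤ theta3 N g Γ₁ Γ₂ Γ₃ Γ₄ ε := by
  have hN' : (0 : ℝ) < N := by exact_mod_cast hN
  exact max_le_max (theta1_anti hN hΓ₂ hΓ₃ hΓ₄ (by positivity) (by gcongr))
    (hΓ₁ _ _ (by positivity) (by gcongr))

theorem theta4_anti (hN : 0 < N) (hg : 0 < g) (hΓ₁ : ∀ ε ε', 0 < ε → ε ≤ ε' → Γ₁ ε' ≤ Γ₁ ε)
    (hΓ₂ : Monotone Γ₂) (hΓ₃ : ∀ ε ε', 0 < ε → ε ≤ ε' → Γ₃ ε' ≤ Γ₃ ε)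
    (hΓ₄ : ∀ ε ε', 0 < ε → ε ≤ ε' → Γ₄ ε' ≤ Γ₄ ε) {ε ε' : ℝ} (hε : 0 < ε) (hle : ε ≤ ε') :
    theta4 N g Γ₁ Γ₂ Γ₃ Γ₄ ε' ≤ theta4 N g Γ₁ Γ₂ Γ₃ Γ₄ ε :=
  max_le_max (theta1_anti hN hΓ₂ hΓ₃ hΓ₄ (by positivity) (by gcongr))
    (theta3_anti hN hg hΓ₁ hΓ₂ hΓ₃ hΓ₄ (by positivity) (by gcongr))

theorem rho_anti (hN : 0 < N) (hg : 0 < g) (hΓ₁ : ∀ ε ε', 0 < ε → ε ≤ ε' → Γ₁ ε' ≤ Γ₁ ε)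
    (hΓ₂ : Monotone Γ₂) (hΓ₃ : ∀ ε ε', 0 < ε → ε ≤ ε' → Γ₃ ε' ≤ Γ₃ ε)
    (hΓ₄ : ∀ ε ε', 0 < ε → ε ≤ ε' → Γ₄ ε' ≤ Γ₄ ε) {ε ε' : ℝ} (hε : 0 < ε) (hle : ε ≤ ε') :
    rho N g Γ₁ Γ₂ Γ₃ Γ₄ ε' ≤ rho N g Γ₁ Γ₂ Γ₃ Γ₄ ε := by
  have hN' : (0 : ℝ) < N := by exact_mod_cast hN
  have h2 := theta3_anti hN hg hΓ₁ hΓ₂ hΓ₃ hΓ₄ (ε := ε / 3) (ε' := ε' / 3) (by positivity)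
    (by gcongr)
  have h3 := max_le_max (theta4_anti hN hg hΓ₁ hΓ₂ hΓ₃ hΓ₄ (ε := ε / 6) (ε' := ε' / 6)
    (by positivity) (by gcongr))
    (hΓ₁ (ε / (4 * (N : ℝ))) (ε' / (4 * (N : ℝ))) (by positivity) (by gcongr))
  simp only [rho, rho2, rho3]
  exact max_le_max (by omega) (by omega)

theorem capSigma_mono (hΓ₂ : Monotone Γ₂) (ε : ℝ) : Monotone (capSigma N g Γ₁ Γ₂ Γ₃ Γ₄ ε) := by
  intro m n hmn
  simp only [capSigma, sigma]
  refine Nat.add_le_add_right (hΓ₂ ?_) 1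
  gcongr

end Antitone


/-! ### Quantitative projection onto the fixed point set -/

theorem iterate_one_mem_Ioc {d : ℝ → ℝ}
    (hd : ∀ ξ ∈ Set.Ioc (0 : ℝ) 1, d ξ ∈ Set.Ioc (0 : ℝ) 1) (i : ℕ) :
    d^[i] 1 ∈ Set.Ioc (0 : ℝ) 1 := by
  induction i with
  | zero => simp
  | succ i ih =>
    rw [Function.iterate_succ_apply']
    exact hd _ ih

theorem phi_pos (N : ℕ) (ε : ℝ) {d : ℝ → ℝ}
    (hd : ∀ ξ ∈ Set.Ioc (0 : ℝ) 1, d ξ ∈ Set.Ioc (0 : ℝ) 1) : 0 < phi N ε d :=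
  (Finset.lt_inf'_iff _).mpr fun i _ => (iterate_one_mem_Ioc hd i).1

/-- Among the first `r + 1` iterates of `d` there is an accuracy `ξ` at which some
`d ξ`-approximate fixed point is, up to `ε`, at least as near to `u` as all `ξ`-approximate fixed
points: otherwise `r + 1` successive improvements by `ε`, starting from the fixed point `p`, would
make `‖u - y‖²` negative. -/
theorem exists_almost_nearest {E : Type*} [SeminormedAddCommGroup E] {S : E → E} {u p : E} {N : ℕ}
    (hSp : S p = p) (hu : 2 * ‖u - p‖ ≤ N) {ε : ℝ} (hε : 0 < ε)
    {d : ℝ → ℝ} (hd : ∀ ξ ∈ Set.Ioc (0 : ℝ) 1, d ξ ∈ Set.Ioc (0 : ℝ) 1) :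
    ∃ ξ ∈ Set.Ioc (0 : ℝ) 1, phi N ε d ≤ ξ ∧ ∃ z, ‖z - p‖ ≤ N ∧ ‖S z - z‖ ≤ d ξ ∧
      ∀ y, ‖y - p‖ ≤ N → ‖S y - y‖ ≤ ξ → ‖u - z‖ ^ 2 ≤ ‖u - y‖ ^ 2 + ε := by
  set r := ⌈(N : ℝ) ^ 2 / (4 * ε)⌉₊ with hr
  have hiter := iterate_one_mem_Ioc hd
  by_contra! hcon
  have hcon' : ∀ i ≤ r, ∀ z, ‖z - p‖ ≤ N → ‖S z - z‖ ≤ d^[i + 1] 1 →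
      ∃ y, ‖y - p‖ ≤ N ∧ ‖S y - y‖ ≤ d^[i] 1 ∧ ‖u - y‖ ^ 2 + ε < ‖u - z‖ ^ 2 := by
    intro i hi z hz hSz
    refine hcon _ (hiter i) ?_ z hz (by rwa [Function.iterate_succ_apply'] at hSz)
    exact Finset.inf'_le _ (Finset.mem_range.mpr (Nat.lt_succ_of_le hi))
  have hdesc : ∀ j ≤ r + 1, ∃ y, ‖y - p‖ ≤ N ∧ ‖S y - y‖ ≤ d^[r + 1 - j] 1 ∧
      ‖u - y‖ ^ 2 + j * ε ≤ N ^ 2 / 4 := by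
    intro j
    induction j with
    | zero =>
      intro _
      refine ⟨p, by simp, by simpa [hSp] using (hiter (r + 1)).1.le, ?_⟩
      have := norm_nonneg (u - p)
      push_cast
      nlinarith
    | succ j ih =>
      intro hj
      obtain ⟨z, hz, hSz, hzu⟩ := ih (by omega)
      rw [show r + 1 - j = (r - j) + 1 by omega] at hSz
      obtain ⟨y, hy, hSy, hyu⟩ := hcon' (r - j) (by omega) z hz hSz
      refine ⟨y, hy, by rwa [show r + 1 - (j + 1) = r - j by omega], ?_⟩
      push_cast
      linarith
  obtain ⟨y, -, -, hy⟩ := hdesc (r + 1) le_rfl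
  have h1 : (N : ℝ) ^ 2 / (4 * ε) ≤ r := Nat.le_ceil _
  rw [div_le_iff₀ (by positivity)] at h1
  push_cast at hy
  nlinarith [sq_nonneg ‖u - y‖]

section Projection

variable {S : H → H} {u p : H} {N : ℕ}

/-- Quantitative form of the convexity of the set of fixed points. -/
theorem norm_S_lineMap_sub_sq_le (hS : ∀ y z, ‖S y - S z‖ ≤ ‖y - z‖) {y z : H} {η t D : ℝ}
    (ht : t ∈ Set.Icc (0 : ℝ) 1) (hz : ‖S z - z‖ ≤ η) (hy : ‖S y - y‖ ≤ η) (hD : ‖z - y‖ ≤ D) :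
    ‖S ((1 - t) • z + t • y) - ((1 - t) • z + t • y)‖ ^ 2 ≤ η * (η + D) := by
  obtain ⟨ht0, ht1⟩ := ht
  set w := (1 - t) • z + t • y with hw
  set d := ‖z - y‖ with hd
  have hη : 0 ≤ η := (norm_nonneg _).trans hz
  have hwz : ‖w - z‖ = t * d := by
    rw [show w - z = -(t • (z - y)) by rw [hw]; module, norm_neg, norm_smul, Real.norm_eq_abs,
      abs_of_nonneg ht0]
  have hwy : ‖w - y‖ = (1 - t) * d := by
    rw [show w - y = (1 - t) • (z - y) by rw [hw]; module, norm_smul, Real.norm_eq_abs,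
      abs_of_nonneg (sub_nonneg.mpr ht1)]
  have h1 : ‖S w - z‖ ≤ t * d + η := by
    have h := norm_sub_le_norm_sub_add_norm_sub (S w) (S z) z
    have := hS w z
    linarith
  have h2 : ‖S w - y‖ ≤ (1 - t) * d + η := by
    have h := norm_sub_le_norm_sub_add_norm_sub (S w) (S y) y
    have := hS w y
    linarith
  have e : S w - w = (1 - t) • (S w - z) + t • (S w - y) := by
    rw [hw]
    module
  have e2 : ‖(S w - z) - (S w - y)‖ = d := by rw [sub_sub_sub_cancel_left, norm_sub_rev]
  rw [e, norm_lineMap_sq, e2]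
  have h1' : ‖S w - z‖ ^ 2 ≤ (t * d + η) ^ 2 := by gcongr
  have h2' : ‖S w - y‖ ^ 2 ≤ ((1 - t) * d + η) ^ 2 := by gcongr
  have h3 := mul_le_mul_of_nonneg_left h1' (sub_nonneg.mpr ht1)
  have h4 := mul_le_mul_of_nonneg_left h2' ht0
  have h5 : 0 ≤ η * d := mul_nonneg hη (norm_nonneg _)
  have h6 := mul_le_mul_of_nonneg_left hD hη
  nlinarith [mul_nonneg h5 (sq_nonneg (1 - 2 * t))]

/-- Quantitative form of the variational characterization of the projection of `u` onto the set of
fixed points. -/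
theorem exists_inner_le_of_capPhi (hS : ∀ y z, ‖S y - S z‖ ≤ ‖y - z‖) (hSp : S p = p)
    (hu : 2 * ‖u - p‖ ≤ N) (hN : 0 < N) {ε : ℝ} (hε : 0 < ε)
    {d : ℝ → ℝ} (hd : ∀ ξ ∈ Set.Ioc (0 : ℝ) 1, d ξ ∈ Set.Ioc (0 : ℝ) 1) :
    0 < capPhi N ε d ∧ ∃ η : ℝ, capPhi N ε d ≤ η ∧ ∃ z, ‖z - p‖ ≤ N ∧ ‖S z - z‖ ≤ d η ∧
      ∀ y, ‖y - p‖ ≤ N → ‖S y - y‖ ≤ η → inner ℝ (u - z) (y - z) ≤ ε := by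
  have hN1 : (1 : ℝ) ≤ N := by exact_mod_cast hN
  set d' : ℝ → ℝ := fun ξ => min (d (ξ ^ 2 / (24 * (N : ℝ)))) (ξ ^ 2 / (24 * (N : ℝ))) with hd'
  have hη : ∀ ξ ∈ Set.Ioc (0 : ℝ) 1, ξ ^ 2 / (24 * (N : ℝ)) ∈ Set.Ioc (0 : ℝ) 1 := by
    rintro ξ ⟨h0, h1⟩
    refine ⟨by positivity, ?_⟩
    rw [div_le_one (by positivity)]
    nlinarith
  have hd'mem : ∀ ξ ∈ Set.Ioc (0 : ℝ) 1, d' ξ ∈ Set.Ioc (0 : ℝ) 1 := fun ξ hξ =>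
    ⟨lt_min (hd _ (hη ξ hξ)).1 (hη ξ hξ).1, (min_le_right _ _).trans (hη ξ hξ).2⟩
  have hε' : 0 < ε ^ 2 / (4 * (N : ℝ) ^ 2) := by positivity
  obtain ⟨ξ, hξ, hphi, z, hz, hSz, hmin⟩ := exists_almost_nearest hSp hu hε' hd'mem
  set η := ξ ^ 2 / (24 * (N : ℝ)) with hηdef
  have hηmem : η ∈ Set.Ioc (0 : ℝ) 1 := hη ξ hξ
  have hphi0 : 0 < phi N (ε ^ 2 / (4 * (N : ℝ) ^ 2)) d' := phi_pos _ _ hd'mem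
  refine ⟨by rw [capPhi]; positivity, η, ?_, z, hz, hSz.trans (min_le_left _ _),
    fun y hy hSy => ?_⟩
  · rw [capPhi, hηdef]
    gcongr
  have hyz : ‖y - z‖ ≤ 2 * N := norm_sub_le_two_mul hy hz
  by_cases hlarge : 4 * (N : ℝ) ^ 2 ≤ ε
  · have h1 := real_inner_le_norm (u - z) (y - z)
    have h2 : ‖u - z‖ ≤ 3 / 2 * N := by
      have := norm_sub_le_norm_sub_add_norm_sub u p z
      rw [norm_sub_rev p z] at this
      linarith
    have h3 : ‖u - z‖ * ‖y - z‖ ≤ 3 / 2 * N * (2 * N) := by gcongr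
    nlinarith
  · -- This `t` balances the error `ε² / (4N²)`, divided by `2t`, against the quadratic term.
    set t : ℝ := ε / (4 * (N : ℝ) ^ 2) with ht
    have ht0 : 0 < t := by positivity
    have ht1 : t ≤ 1 := by
      rw [ht, div_le_one (by positivity)]
      exact (not_le.mp hlarge).le
    set w := (1 - t) • z + t • y with hw
    have hwp : ‖w - p‖ ≤ N := by
      rw [show w - p = (1 - t) • (z - p) + t • (y - p) by rw [hw]; module]
      exact norm_lineMap_le ⟨ht0.le, ht1⟩ hz hy
    have hSw : ‖S w - w‖ ≤ ξ := by
      have h := norm_S_lineMap_sub_sq_le hS ⟨ht0.le, ht1⟩ (hSz.trans (min_le_right _ _)) hSy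
        (D := 2 * N) (by rwa [norm_sub_rev])
      refine le_of_sq_le_sq (h.trans ?_) hξ.1.le
      have e : ξ ^ 2 = η * (24 * N) := by rw [hηdef]; field_simp
      have := hηmem.2
      exact (mul_le_mul_of_nonneg_left (by linarith) hηmem.1.le).trans_eq e.symm
    have h := hmin w hwp hSw
    have e : u - w = (u - z) - t • (y - z) := by rw [hw]; module
    rw [e, norm_sub_sq_real (u - z), inner_smul_right, norm_smul, mul_pow, Real.norm_eq_abs,
      sq_abs] at h
    have h1 : ‖y - z‖ ^ 2 ≤ (2 * N) ^ 2 := by gcongr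
    have h2 := mul_le_mul_of_nonneg_left h1 (sq_nonneg t)
    have e1 : t * (4 * N ^ 2) = ε := by rw [ht]; field_simp
    have e2 : ε ^ 2 / (4 * (N : ℝ) ^ 2) = t * ε := by rw [ht]; ring
    rw [e2] at h
    have h3 : t * (2 * inner ℝ (u - z) (y - z)) ≤ t * (2 * ε) := by
      have : t ^ 2 * (2 * N) ^ 2 = t * ε := by rw [← e1]; ring
      linarith
    have := le_of_mul_le_mul_left h3 ht0
    linarith

end Projection

/-! ### Metastability and strong convergence of the Halpern–Mann iteration -/

namespace IsHalpernMann

variable {S : H → H} {α β : ℕ → ℝ} {u p : H} {x : ℕ → H} {N : ℕ} {g : ℝ}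
  {Γ₁ : ℝ → ℕ} {Γ₂ : ℕ → ℕ} {Γ₃ Γ₄ : ℝ → ℕ}

theorem norm_even_succ_sub_sq_le (h : IsHalpernMann S α β u p x N g) {z : H} (hz : ‖z - p‖ ≤ N)
    {δ : ℝ} (hδ : ‖S z - z‖ ≤ δ) (hδ1 : δ ≤ 1) (n : ℕ) :
    ‖x (2 * n + 2) - z‖ ^ 2 ≤ (1 - α n) * ‖x (2 * n) - z‖ ^ 2
      + 2 * α n * inner ℝ (u - z) (x (2 * n + 1) - z) + 5 * N * δ := by
  have hN := h.one_le_N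
  set y := x (2 * n + 1) with hy
  have hδ0 : 0 ≤ δ := (norm_nonneg _).trans hδ
  have hyz : ‖y - z‖ ≤ 2 * N := norm_sub_le_two_mul (h.norm_sub_le _) hz
  have hmann : ‖x (2 * n + 2) - z‖ ≤ ‖y - z‖ + δ := by
    rw [h.mann_sub n z]
    refine norm_lineMap_le (h.mem_Icc_beta n) ?_ (by linarith)
    have h1 := norm_sub_le_norm_sub_add_norm_sub (S y) (S z) z
    have h2 := h.nonexpansive y z
    linarith
  have hmann2 : ‖x (2 * n + 2) - z‖ ^ 2 ≤ ‖y - z‖ ^ 2 + 5 * N * δ := by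
    have h1 : ‖x (2 * n + 2) - z‖ ^ 2 ≤ (‖y - z‖ + δ) ^ 2 := by gcongr
    nlinarith [mul_le_mul_of_nonneg_right hyz hδ0]
  have hhal : ‖y - z‖ ^ 2 ≤ (1 - α n) * ‖x (2 * n) - z‖ ^ 2
      + 2 * α n * inner ℝ (u - z) (y - z) := by
    obtain ⟨ha0, ha1⟩ := h.mem_alpha n
    have e : (1 - α n) • (x (2 * n) - z) = (y - z) - α n • (u - z) := by
      rw [hy, h.halpern_sub n z]
      abel
    have e1 : (1 - α n) ^ 2 * ‖x (2 * n) - z‖ ^ 2 = ‖y - z‖ ^ 2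
        - 2 * α n * inner ℝ (u - z) (y - z) + (α n) ^ 2 * ‖u - z‖ ^ 2 := by
      have h1 : ‖(1 - α n) • (x (2 * n) - z)‖ ^ 2 = ‖(y - z) - α n • (u - z)‖ ^ 2 := by rw [e]
      rw [norm_sub_sq_real, norm_smul, norm_smul, mul_pow, mul_pow, Real.norm_eq_abs,
        Real.norm_eq_abs, sq_abs, sq_abs, inner_smul_right, real_inner_comm] at h1
      linarith
    have h2 : 0 ≤ (α n) ^ 2 * ‖u - z‖ ^ 2 := by positivity
    have h3 : 0 ≤ α n * (1 - α n) * ‖x (2 * n) - z‖ ^ 2 :=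
      mul_nonneg (mul_nonneg ha0 (sub_nonneg.mpr ha1)) (sq_nonneg _)
    linarith
  linarith

/-- If `z` is almost fixed and almost satisfies the variational inequality along the tail of the
iteration from `k` on, then even terms are near `z`, from an index determined by the divergence of
`∑ α` up to the index `b` at which the accumulated errors of the approximate fixed point `z` become
too large. -/
theorem norm_even_sub_sq_le (h : IsHalpernMann S α β u p x N g)
    (hΓ₂ : IsMonotoneRateOfDivergence α Γ₂) {z : H} (hz : ‖z - p‖ ≤ N) {ε δ : ℝ} (hε : 0 < ε)
    (hδ : ‖S z - z‖ ≤ δ) (hδ1 : δ ≤ 1) {k b m : ℕ} (hδb : δ * (30 * N * (b + 1)) ≤ ε)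
    (hinner : ∀ i, k ≤ i → inner ℝ (u - z) (x i - z) ≤ ε / 24)
    (hm : sigma Γ₂ (4 * N ^ 2) ε k ≤ m) (hmb : m ≤ b) : ‖x (2 * m) - z‖ ^ 2 ≤ ε := by
  have hN := h.one_le_N
  have hδ0 : 0 ≤ δ := (norm_nonneg _).trans hδ
  have hD : (0 : ℝ) < 4 * N ^ 2 := by positivity
  obtain ⟨hsum, hle⟩ := hΓ₂.le_sum_Ico h.mem_alpha hm
  obtain ⟨j, rfl⟩ := Nat.exists_eq_add_of_le hle
  have hk : ‖x (2 * k) - z‖ ^ 2 - ε / 12 ≤ 4 * N ^ 2 := by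
    have h1 := norm_sub_le_two_mul (h.norm_sub_le (2 * k)) hz
    have h2 : ‖x (2 * k) - z‖ ^ 2 ≤ (2 * N) ^ 2 := by gcongr
    linarith
  have hrec := le_exp_neg_sum_add_sum (s := fun i => ‖x (2 * i) - z‖ ^ 2 - ε / 12)
    (b := fun _ => 5 * N * δ) (n := j) hD.le hk h.mem_alpha (fun _ _ => by positivity)
    (fun i hi => by
      have h1 := h.norm_even_succ_sub_sq_le hz hδ hδ1 i
      have h2 := mul_le_mul_of_nonneg_left
        (hinner (2 * i + 1) (by have := (Finset.mem_Ico.mp hi).1; omega)) (h.mem_alpha i).1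
      rw [show 2 * (i + 1) = 2 * i + 2 by ring]
      linarith)
  have hexp : (4 * (N : ℝ) ^ 2) * Real.exp (-∑ i ∈ Finset.Ico k (k + j), α i) ≤ ε / 3 := by
    refine mul_exp_neg_le_of_log_le hD (by positivity) (le_trans ?_ hsum)
    rw [div_div_eq_mul_div, mul_comm]
    push_cast
    exact Nat.le_ceil _
  have herr : ∑ _i ∈ Finset.Ico k (k + j), 5 * (N : ℝ) * δ ≤ ε / 6 := by
    rw [Finset.sum_const, Nat.card_Ico, nsmul_eq_mul, Nat.add_sub_cancel_left]
    have hj : (j : ℝ) ≤ b := by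
      have : j ≤ b := by omega
      exact_mod_cast this
    have h1 : 0 ≤ 5 * (N : ℝ) * δ := by positivity
    have h2 := mul_le_mul_of_nonneg_right hj h1
    linarith
  linarith

theorem isRateOfMetastability (h : IsHalpernMann S α β u p x N g)
    (hΓ₁ : IsMonotoneRateToZero α Γ₁) (hΓ₂ : IsMonotoneRateOfDivergence α Γ₂)
    (hΓ₃ : IsMonotoneCauchyRateOfVariation α Γ₃) (hΓ₄ : IsMonotoneCauchyRateOfVariation β Γ₄) :
    IsRateOfMetastability x (mu N g Γ₁ Γ₂ Γ₃ Γ₄) := by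
  intro ε hε f
  have hN := h.one_le_N
  set ε' := ε ^ 2 / 16 with hε'
  have hε'0 : 0 < ε' := by positivity
  have hΓ₂m : Monotone Γ₂ := fun _ _ hk => hΓ₂.2 _ _ hk
  set ρ := rho N g Γ₁ Γ₂ Γ₃ Γ₄ with hρ
  set Δ := capDelta N g Γ₁ Γ₂ Γ₃ Γ₄ ε f with hΔ
  -- `z` is so nearly fixed that its errors stay small up to the end of the window for `k = ρ η`.
  obtain ⟨hPhi, η, hle, z, hz, hSz, hinner⟩ := exists_inner_le_of_capPhi h.nonexpansive h.fixed
    h.norm_anchor h.pos_N (ε := ε' / 24) (by positivity) (d := fun η => Δ (ρ η))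
    (fun ξ _ => ⟨lt_min (by positivity) one_pos, min_le_right _ _⟩)
  have hη : 0 < η := hPhi.trans_le hle
  set k := ρ η with hk
  have hkPsi : k ≤ capPsi N ρ (ε' / 24) Δ :=
    rho_anti h.pos_N h.pos_g hΓ₁.2 hΓ₂m hΓ₃.2 hΓ₄.2 hPhi hle
  set M := max (capSigma N g Γ₁ Γ₂ Γ₃ Γ₄ ε k) (theta4 N g Γ₁ Γ₂ Γ₃ Γ₄ (ε / 4)) with hM
  have hP : capP N g Γ₁ Γ₂ Γ₃ Γ₄ ε f k = f (2 * M + 1) := rfl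
  have hnear : ∀ m, M ≤ m → 2 * m ≤ f (2 * M + 1) →
      ‖x (2 * m) - z‖ ≤ ε / 4 := by
    intro m hm hmf
    refine le_of_sq_le_sq ?_ (by positivity)
    have hΔk : Δ k * (30 * N * ((f (2 * M + 1) : ℝ) + 1)) ≤ ε' := by
      rw [← le_div_iff₀ (by positivity), ← hP]
      exact min_le_left _ _
    rw [show (ε / 4) ^ 2 = ε' by rw [hε']; ring]
    refine h.norm_even_sub_sq_le hΓ₂ hz hε'0 hSz (min_le_right _ _) hΔk (fun i hi => ?_)
      ((le_max_left _ _).trans hm) (by omega)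
    refine hinner _ (h.norm_sub_le i) (h.norm_S_sub_le_of_rho_le hΓ₁ hΓ₂ hΓ₃ hΓ₄ hη ?_)
    exact (le_max_left _ _).trans hi
  have hall : ∀ i ∈ Set.Icc (2 * M + 1) (f (2 * M + 1)), ‖x i - z‖ ≤ ε / 2 := by
    rintro i ⟨hi1, hi2⟩
    rcases Nat.even_or_odd' i with ⟨m, rfl | rfl⟩
    · have := hnear m (by omega) hi2
      linarith
    · have h1 := hnear m (by omega) (by omega)
      have h2 := h.norm_odd_sub_even_le_of_theta4_le hΓ₁ hΓ₂ hΓ₃ hΓ₄ (ε := ε / 4) (n := m)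
        (by positivity) (by omega)
      have h3 := norm_sub_le_norm_sub_add_norm_sub (x (2 * m + 1)) (x (2 * m)) z
      linarith
  refine ⟨2 * M + 1, ?_, fun i hi j hj => ?_⟩
  · have := capSigma_mono (N := N) (g := g) (Γ₁ := Γ₁) (Γ₃ := Γ₃) (Γ₄ := Γ₄) hΓ₂m ε hkPsi
    have := max_le_max_right (theta4 N g Γ₁ Γ₂ Γ₃ Γ₄ (ε / 4)) this
    exact Nat.add_le_add_right (Nat.mul_le_mul_left 2 this) 1
  · rw [dist_eq_norm]
    have h1 := hall i hi
    have h2 := hall j hj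
    have h3 := norm_sub_le_norm_sub_add_norm_sub (x i) z (x j)
    rw [norm_sub_rev z] at h3
    linarith

end IsHalpernMann

theorem IsRateOfMetastability.cauchySeq {X : Type*} [MetricSpace X] {x : ℕ → X}
    {m : ℝ → (ℕ → ℕ) → ℕ} (h : IsRateOfMetastability x m) : CauchySeq x := by
  rw [Metric.cauchySeq_iff']
  by_contra! hcon
  obtain ⟨ε, hε, hcon⟩ := hcon
  -- A function choosing a counterexample to the Cauchy property refutes metastability.
  choose f hf hfε using hcon
  obtain ⟨n, -, hn⟩ := h (ε / 2) (half_pos hε) f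
  have := hn (f n) ⟨hf n, le_rfl⟩ n ⟨le_rfl, hf n⟩
  linarith [hfε n]

namespace IsHalpernMann

variable {S : H → H} {α β : ℕ → ℝ} {u p : H} {x : ℕ → H} {N : ℕ} {g : ℝ}
  {Γ₁ : ℝ → ℕ} {Γ₂ : ℕ → ℕ} {Γ₃ Γ₄ : ℝ → ℕ}

theorem fixed_of_tendsto (h : IsHalpernMann S α β u p x N g)
    (hΓ₁ : IsMonotoneRateToZero α Γ₁) (hΓ₂ : IsMonotoneRateOfDivergence α Γ₂)
    (hΓ₃ : IsMonotoneCauchyRateOfVariation α Γ₃) (hΓ₄ : IsMonotoneCauchyRateOfVariation β Γ₄)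
    {z : H} (hz : Filter.Tendsto x Filter.atTop (nhds z)) : S z = z := by
  have hS : Continuous S :=
    (LipschitzWith.of_dist_le' (K := 1) fun y z => by
      simpa only [dist_eq_norm, one_mul] using h.nonexpansive y z).continuous
  have hlim := (((hS.tendsto z).comp hz).sub hz).norm
  have hle : ‖S z - z‖ ≤ 0 := le_of_forall_pos_le_add fun ε hε => by
    rw [zero_add]
    refine le_of_tendsto hlim (Filter.eventually_atTop.mpr
      ⟨rho N g Γ₁ Γ₂ Γ₃ Γ₄ ε, fun n hn => ?_⟩)
    exact h.norm_S_sub_le_of_rho_le hΓ₁ hΓ₂ hΓ₃ hΓ₄ hε hn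
  exact sub_eq_zero.mp (norm_le_zero_iff.mp hle)

/-- The recursion for `‖x (2n) - p‖²` drives its limit below that of the forcing term. -/
theorem norm_sub_sq_le_inner_of_tendsto (h : IsHalpernMann S α β u p x N g)
    (hΓ₂ : IsMonotoneRateOfDivergence α Γ₂) {z : H}
    (hz : Filter.Tendsto x Filter.atTop (nhds z)) :
    ‖z - p‖ ^ 2 ≤ 2 * inner ℝ (u - p) (z - p) := by
  refine le_of_forall_pos_le_add fun ε hε => ?_
  set r := 2 * inner ℝ (u - p) (z - p) + ε with hr
  have hforce : Filter.Tendsto (fun i => 2 * inner ℝ (u - p) (x i - p)) Filter.atTop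
      (nhds (2 * inner ℝ (u - p) (z - p))) :=
    (tendsto_const_nhds.inner (hz.sub_const p)).const_mul 2
  obtain ⟨k, hk⟩ := Filter.eventually_atTop.mp
    (hforce.eventually_le_const (show _ < r by rw [hr]; linarith))
  have hrec : ∀ j, ‖x (2 * (k + j)) - p‖ ^ 2 - r
      ≤ |‖x (2 * k) - p‖ ^ 2 - r| * Real.exp (-∑ i ∈ Finset.Ico k (k + j), α i) := by
    intro j
    have := le_exp_neg_sum_add_sum (s := fun i => ‖x (2 * i) - p‖ ^ 2 - r) (k := k)
      (b := fun _ => 0) (n := j) (abs_nonneg _) (le_abs_self _) h.mem_alpha (fun _ _ => le_rfl)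
      (fun i hi => by
        have h1 := h.norm_even_succ_sub_sq_le (z := p) (δ := 0) (by simp)
          (by simp [h.fixed]) zero_le_one i
        have h2 := mul_le_mul_of_nonneg_left
          (hk (2 * i + 1) (by have := (Finset.mem_Ico.mp hi).1; omega)) (h.mem_alpha i).1
        rw [show 2 * (i + 1) = 2 * i + 2 by ring]
        linarith)
    simpa using this
  have hsum : Filter.Tendsto (fun j => ∑ i ∈ Finset.Ico k (k + j), α i) Filter.atTop
      Filter.atTop := by
    refine Filter.tendsto_atTop.mpr fun b => Filter.eventually_atTop.mpr
      ⟨Γ₂ (k + ⌈b⌉₊) + 1, fun j hj => (Nat.le_ceil b).trans ?_⟩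
    exact (hΓ₂.le_sum_Ico h.mem_alpha (m := k + j) (by omega)).1
  have hexp : Filter.Tendsto (fun j => |‖x (2 * k) - p‖ ^ 2 - r|
      * Real.exp (-∑ i ∈ Finset.Ico k (k + j), α i)) Filter.atTop (nhds 0) := by
    simpa using ((Real.tendsto_exp_neg_atTop_nhds_zero.comp hsum).const_mul
      |‖x (2 * k) - p‖ ^ 2 - r|)
  have hsub : Filter.Tendsto (fun j => 2 * (k + j)) Filter.atTop Filter.atTop :=
    Filter.tendsto_atTop_mono (fun j => show j ≤ _ by omega) Filter.tendsto_id
  have hleft : Filter.Tendsto (fun j => ‖x (2 * (k + j)) - p‖ ^ 2 - r) Filter.atTop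
      (nhds (‖z - p‖ ^ 2 - r)) :=
    ((((hz.comp hsub).sub_const p).norm).pow 2).sub_const r
  have := le_of_tendsto_of_tendsto' hleft hexp hrec
  linarith

/-- The hypotheses hold relative to every fixed point, with a suitable bound. -/
theorem exists_of_fixed (h : IsHalpernMann S α β u p x N g) {q : H} (hq : S q = q) :
    ∃ M, IsHalpernMann S α β u q x M g := by
  obtain ⟨M, hM⟩ := exists_nat_ge (max ‖x 0 - q‖ (2 * ‖u - q‖))
  have hle : (M : ℝ) ≤ (M + 1 : ℕ) := by exact_mod_cast Nat.le_succ M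
  exact ⟨M + 1, { h with
    fixed := hq
    pos_N := Nat.succ_pos M
    norm_init := ((le_max_left _ _).trans hM).trans hle
    norm_anchor := ((le_max_right _ _).trans hM).trans hle }⟩

theorem isMetricProjection_of_tendsto (h : IsHalpernMann S α β u p x N g)
    (hΓ₁ : IsMonotoneRateToZero α Γ₁) (hΓ₂ : IsMonotoneRateOfDivergence α Γ₂)
    (hΓ₃ : IsMonotoneCauchyRateOfVariation α Γ₃) (hΓ₄ : IsMonotoneCauchyRateOfVariation β Γ₄)
    {z : H} (hz : Filter.Tendsto x Filter.atTop (nhds z)) :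
    IsMetricProjection {y | S y = y} u z := by
  have hfix : S z = z := h.fixed_of_tendsto hΓ₁ hΓ₂ hΓ₃ hΓ₄ hz
  have hnear : ∀ q, S q = q → dist u z ≤ dist u q := by
    intro q hq
    obtain ⟨M, hM⟩ := h.exists_of_fixed hq
    have h1 := hM.norm_sub_sq_le_inner_of_tendsto hΓ₂ hz
    rw [dist_eq_norm, dist_eq_norm]
    refine le_of_sq_le_sq ?_ (norm_nonneg _)
    rw [show u - z = (u - q) - (z - q) by abel, norm_sub_sq_real]
    linarith
  refine ⟨hfix, hnear, fun z' hz' hmin => ?_⟩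
  set w := (1 - (1 / 2 : ℝ)) • z + (1 / 2 : ℝ) • z' with hw
  have hSw : S w = w := by
    have h1 := norm_S_lineMap_sub_sq_le h.nonexpansive (y := z') (z := z) (η := 0) (t := 1 / 2)
      ⟨by norm_num, by norm_num⟩ (by simp [hfix])
      (by rw [show S z' = z' from hz', sub_self, norm_zero]) le_rfl
    rw [zero_mul] at h1
    have h2 : ‖S w - w‖ ^ 2 = 0 := le_antisymm h1 (sq_nonneg _)
    exact sub_eq_zero.mp (norm_eq_zero.mp (pow_eq_zero_iff two_ne_zero |>.mp h2))
  have h1 := hnear w hSw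
  have h2 := hmin z hfix
  have h3 := norm_lineMap_sq (1 / 2) (u - z) (u - z')
  rw [show (1 - (1 / 2 : ℝ)) • (u - z) + (1 / 2 : ℝ) • (u - z') = u - w by rw [hw]; module,
    sub_sub_sub_cancel_left] at h3
  rw [dist_eq_norm, dist_eq_norm] at h1 h2
  have h4 : ‖u - z‖ ^ 2 ≤ ‖u - w‖ ^ 2 := by gcongr
  have h5 : ‖u - z'‖ ^ 2 ≤ ‖u - z‖ ^ 2 := by gcongr
  have h6 : ‖z' - z‖ ^ 2 = 0 := le_antisymm (by linarith) (sq_nonneg _)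
  exact sub_eq_zero.mp (norm_eq_zero.mp (pow_eq_zero_iff two_ne_zero |>.mp h6))

end IsHalpernMann

/-! ### Reduction of the forward-backward algorithm -/

/-- A forward-backward step with weight `β` is a Mann step of the nonexpansive relaxation with
weight `1 - a (1 - β)`, where `a = 2δ / (4δ - c)` lies in `[1/2, 1]`. -/
theorem IsGFB.isHalpernMann [CompleteSpace H] {U₁ : H → Set H} (hU₁ : IsMaximalMonotoneOp U₁)
    {δ : ℝ} (hδ : 0 < δ) {U₂ : H → H} (hU₂ : IsCocoercive δ U₂) {c : ℝ}
    (hc : c ∈ Set.Ioc 0 (2 * δ)) {α β : ℕ → ℝ} (hα : ∀ n, α n ∈ Set.Icc (0 : ℝ) 1) {u : H}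
    {x : ℕ → H} (hx : IsGFB U₁ U₂ c α β u x) {N : ℕ} (hN : 0 < N) {p : H}
    (hp : p ∈ zer (addOp U₁ U₂)) (hpN : max ‖x 0 - p‖ (2 * ‖u - p‖) ≤ (N : ℝ)) {γ : ℝ}
    (hγ : 0 < γ) (hβγ : ∀ n, 1 - (4 * δ - c) / (2 * δ) + γ ≤ β n ∧ β n ≤ 1 - γ) :
    IsHalpernMann (forwardBackwardRelax U₁ U₂ δ c) α
      (fun n => 1 - 2 * δ / (4 * δ - c) * (1 - β n)) u p x N (γ / 2) := by
  have hden : 0 < 4 * δ - c := by linarith [hc.2]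
  set a := 2 * δ / (4 * δ - c) with ha
  have hκ : (4 * δ - c) / (2 * δ) = a⁻¹ := by rw [ha, inv_div]
  have ha0 : 0 < a := by positivity
  have ha2 : 1 / 2 ≤ a := by
    rw [ha, div_le_div_iff₀ two_pos hden]
    linarith [hc.1]
  have haa : a * a⁻¹ = 1 := mul_inv_cancel₀ ha0.ne'
  refine
    { nonexpansive := norm_forwardBackwardRelax_sub_le hU₁ hδ hU₂ hc
      fixed := (forwardBackwardRelax_eq_self_iff hU₁ U₂ hδ hc p).mpr hp
      halpern := fun n => (hx n).1
      mann := fun n => ?_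
      mem_alpha := hα
      mem_beta := fun n => ?_
      pos_g := half_pos hγ
      pos_N := hN
      norm_init := (le_max_left _ _).trans hpN
      norm_anchor := (le_max_right _ _).trans hpN }
  · rw [(hx n).2]
    simp only [forwardBackwardRelax, hκ]
    change (1 - β n) • forwardBackward U₁ U₂ c (x (2 * n + 1)) + _ = _
    have e : (1 - (1 - a * (1 - β n))) • a⁻¹ • (forwardBackward U₁ U₂ c (x (2 * n + 1))
        - x (2 * n + 1)) = (1 - β n) • (forwardBackward U₁ U₂ c (x (2 * n + 1))
        - x (2 * n + 1)) := by
      rw [smul_smul]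
      congr 1
      linear_combination (1 - β n) * haa
    rw [smul_add, e]
    module
  · obtain ⟨h1, h2⟩ := hβγ n
    rw [hκ] at h1
    constructor <;> nlinarith

end HalpernMann

theorem mainTheorem6 {H : Type*} [NormedAddCommGroup H] [InnerProductSpace ℝ H] [CompleteSpace H]
    (U₁ : H → Set H) (hU₁ : HalpernMann.IsMaximalMonotoneOp U₁)
    (δ : ℝ) (hδ : 0 < δ) (U₂ : H → H) (hU₂ : HalpernMann.IsCocoercive δ U₂)
    (c : ℝ) (hc : c ∈ Set.Ioc 0 (2 * δ))
    (α β : ℕ → ℝ) (hα : ∀ n, α n ∈ Set.Icc (0 : ℝ) 1)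
    (hβ : ∀ n, β n ∈ Set.Icc (1 - (4 * δ - c) / (2 * δ)) 1)
    (Γ₁ : ℝ → ℕ) (Γ₂ : ℕ → ℕ) (Γ₃ Γ₄ : ℝ → ℕ)
    (hΓ₁ : HalpernMann.IsMonotoneRateToZero α Γ₁)
    (hΓ₂ : HalpernMann.IsMonotoneRateOfDivergence α Γ₂)
    (hΓ₃ : HalpernMann.IsMonotoneCauchyRateOfVariation α Γ₃)
    (hΓ₄ : HalpernMann.IsMonotoneCauchyRateOfVariation β Γ₄)
    (u : H) (x : ℕ → H) (hx : HalpernMann.IsGFB U₁ U₂ c α β u x)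
    (N : ℕ) (hN : 0 < N)
    (hp : ∃ p ∈ HalpernMann.zer (HalpernMann.addOp U₁ U₂),
      max ‖x 0 - p‖ (2 * ‖u - p‖) ≤ (N : ℝ))
    (γ : ℝ) (hγ : γ ∈ Set.Ioc (0 : ℝ) 1)
    (hβγ : ∀ n, 1 - (4 * δ - c) / (2 * δ) + γ ≤ β n ∧ β n ≤ 1 - γ) :
    (∃ z : H, HalpernMann.IsMetricProjection (HalpernMann.zer (HalpernMann.addOp U₁ U₂)) u z ∧
      Filter.Tendsto x Filter.atTop (nhds z)) ∧
    HalpernMann.IsRateOfMetastability x (HalpernMann.mu N (γ / 2) Γ₁ Γ₂ Γ₃ Γ₄) := by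
  obtain ⟨p, hp, hpN⟩ := hp
  have h := hx.isHalpernMann hU₁ hδ hU₂ hc hα hN hp hpN hγ.1 hβγ
  have hvar : HalpernMann.IsMonotoneCauchyRateOfVariation
      (fun n => 1 - 2 * δ / (4 * δ - c) * (1 - β n)) Γ₄ := by
    refine ⟨fun ε hε n => le_trans (Finset.sum_le_sum fun i _ => ?_) (hΓ₄.1 ε hε n), hΓ₄.2⟩
    have hden : 0 < 4 * δ - c := by linarith [hc.2, hδ]
    rw [show 1 - 2 * δ / (4 * δ - c) * (1 - β (i + 1)) - (1 - 2 * δ / (4 * δ - c) * (1 - β i))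
      = 2 * δ / (4 * δ - c) * (β (i + 1) - β i) by ring, abs_mul, abs_of_pos (by positivity)]
    refine mul_le_of_le_one_left (abs_nonneg _) ?_
    rw [div_le_one hden]
    linarith [hc.2]
  have hmeta := h.isRateOfMetastability hΓ₁ hΓ₂ hΓ₃ hvar
  obtain ⟨z, hz⟩ := cauchySeq_tendsto_of_complete hmeta.cauchySeq
  have hzer : {y | HalpernMann.forwardBackwardRelax U₁ U₂ δ c y = y}
      = HalpernMann.zer (HalpernMann.addOp U₁ U₂) :=
    Set.ext fun y => HalpernMann.forwardBackwardRelax_eq_self_iff hU₁ U₂ hδ hc y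
  exact ⟨⟨z, hzer ▸ h.isMetricProjection_of_tendsto hΓ₁ hΓ₂ hΓ₃ hvar hz, hz⟩, hmeta⟩
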